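/- Let $U\subset\mathbb R$ be an open neighbourhood of $0$, let $c:U\to\mathbb R$ satisfy $c(0)=1$, and let $\varphi\in C_b^2(\mathbb R)$, $\psi\in C_b^1(\mathbb R)$, where $C_b^m(\mathbb R)$ is the space of $C^m$ functions that are bounded together with all their derivatives up to order $m$. For $\varepsilon>0$ consider the Cauchy problem $$u_{tt}-c(u_x)^2u_{xx}=0,\qquad u(0,x)=\varepsilon\varphi(x),\quad u_t(0,x)=\varepsilon\psi(x)\qquad(x\in\mathbb R),$$ and let its lifespan $T^*=T^*(\varepsilon)\in[0,\infty]$ be the supremum of all $T>0$ for which there is a classical ($C^2$) solution $u$ on $[0,T)\times\mathbb R$, with $u_x$ taking values in $U$, such that $$\sup_{t\in[0,T)}\Bigl(\|u(t)\|_{L^\infty}+\|u_t(t)\|_{L^\infty}+\|u_x(t)\|_{L^\infty}+\|u_{tt}(t)\|_{L^\infty}+\|u_{tx}(t)\|_{L^\infty}+\|u_{xx}(t)\|_{L^\infty}+\|c(u_x(t))^{-1}\|_{L^\infty}\Bigr)<\infty.$$ (a) Suppose that $p>2$ is a real number such that $c\in C^{\lceil p-2\rceil,\,p-\lceil p-1\rceil}(U)$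 (that is, $c$ is $C^{\lceil p-2\rceil}$ on $U$ and $c^{(\lceil p-2\rceil)}$ is Hölder continuous on $U$ with exponent $p-\lceil p-1\rceil\in(0,1]$), $c'(0)=\dots=c^{(\lceil p-2\rceil)}(0)=0$, and for some constant $K>0$ $$\bigl|c^{(\lceil p-2\rceil)}(\theta)\bigr|\le K|\theta|^{p-\lceil p-1\rceil}\quad\text{for all }\theta\in U.$$ Then there are constants $\varepsilon_0>0$ and $C>0$, with $C$ independent of $\varepsilon$, such that $T^*\ge C\varepsilon^{-(p-1)}$ whenever $0<\varepsilon\le\varepsilon_0$. (b) Suppose instead that $c\in C^1(U)$ and $c'(0)\neq0$. Then there are constants $\varepsilon_0>0$ and $C>0$, with $C$ independent of $\varepsilon$, such that $T^*\ge C\varepsilon^{-1}$ whenever $0<\varepsilon\le\varepsilon_0$. -/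

import Mathlib

open MeasureTheory Set
open scoped ENNReal NNReal

noncomputable section

namespace QuasilinearWave

/-- `C_b^m(ℝ)`: `m` times continuously differentiable functions that are bounded together with
all their derivatives up to order `m`. -/
def IsCb (m : ℕ) (f : ℝ → ℝ) : Prop :=
  ContDiff ℝ m f ∧ ∀ k ≤ m, ∃ B : ℝ, ∀ x, |iteratedDeriv k f x| ≤ B

/-- `C^{m,α}(U)` for an open set `U ⊆ ℝ`: `m` times continuously differentiable on `U`, with
`m`-th derivative Hölder continuous on `U` with exponent `α`. -/
def IsCHolder (m : ℕ) (α : ℝ≥0) (U : Set ℝ) (f : ℝ → ℝ) : Prop :=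
  ContDiffOn ℝ m f U ∧ ∃ K : ℝ≥0, HolderOnWith K α (iteratedDeriv m f) U

/-- The wave speed `c` is flat of order `⌈p-2⌉` at the origin, with the Hölder-type bound.
For `p > 2` the exponent `p - ⌈p-1⌉` lies in `(0, 1]` and the order `⌈p-2⌉` is at least `1`. -/
def FlatSpeed (p : ℝ) (U : Set ℝ) (c : ℝ → ℝ) : Prop :=
  IsCHolder ⌈p - 2⌉₊ (p - (⌈p - 1⌉ : ℝ)).toNNReal U c ∧
  (∀ k : ℕ, 1 ≤ k → k ≤ ⌈p - 2⌉₊ → iteratedDeriv k c 0 = 0) ∧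
  ∃ K : ℝ, 0 < K ∧ ∀ θ ∈ U, |iteratedDeriv ⌈p - 2⌉₊ c θ| ≤ K * |θ| ^ (p - (⌈p - 1⌉ : ℝ))

/-- Time derivative `u_t` of a function `u (t, x)` on `t ≥ 0` (one-sided at `t = 0`). -/
def dt (u : ℝ → ℝ → ℝ) : ℝ → ℝ → ℝ :=
  fun t x => derivWithin (fun s => u s x) (Ici 0) t

/-- Space derivative `u_x` of a function `u (t, x)`. -/
def dx (u : ℝ → ℝ → ℝ) : ℝ → ℝ → ℝ :=
  fun t x => deriv (fun y => u t y) x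

/-- `u` is a classical (`C²`) solution on `[0,T) × ℝ` of `u_tt - c(u_x)² u_xx = 0` with
`u(0,·) = u₀` and `u_t(0,·) = u₁`, where the speed `c` has domain `U`. -/
structure IsClassicalSolution (U : Set ℝ) (c u₀ u₁ : ℝ → ℝ) (T : ℝ) (u : ℝ → ℝ → ℝ) : Prop where
  contDiffOn : ContDiffOn ℝ 2 (fun q : ℝ × ℝ => u q.1 q.2) (Ico 0 T ×ˢ univ)
  mem_domain : ∀ t ∈ Ico 0 T, ∀ x, dx u t x ∈ U
  equation : ∀ t ∈ Ico 0 T, ∀ x, dt (dt u) t x - c (dx u t x) ^ 2 * dx (dx u) t x = 0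
  initial_pos : ∀ x, u 0 x = u₀ x
  initial_vel : ∀ x, dt u 0 x = u₁ x

/-- The quantity
`‖u‖ + ‖u_t‖ + ‖u_x‖ + ‖u_tt‖ + ‖u_tx‖ + ‖u_xx‖ + ‖c(u_x)⁻¹‖` at time `t`, with `L^∞(ℝ)` norms.
The inverse in the last summand is taken in `[0,∞]`, so that it is infinite where `c(u_x) = 0`. -/
def size (c : ℝ → ℝ) (u : ℝ → ℝ → ℝ) (t : ℝ) : ℝ≥0∞ :=
  eLpNorm (u t) ∞ volume + eLpNorm (dt u t) ∞ volume + eLpNorm (dx u t) ∞ volume +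
  eLpNorm (dt (dt u) t) ∞ volume + eLpNorm (dx (dt u) t) ∞ volume +
  eLpNorm (dx (dx u) t) ∞ volume +
  eLpNorm (fun x => (‖c (dx u t x)‖ₑ)⁻¹) ∞ volume

/-- The lifespan `T* ∈ [0,∞]`: the supremum of all `T > 0` such that the Cauchy problem has a
classical solution on `[0,T) × ℝ` for which `sup_{t ∈ [0,T)} size c u t` is finite. -/
def lifespan (U : Set ℝ) (c u₀ u₁ : ℝ → ℝ) : ℝ≥0∞ :=
  sSup {τ : ℝ≥0∞ | ∃ T : ℝ, 0 < T ∧ τ = ENNReal.ofReal T ∧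
    ∃ u : ℝ → ℝ → ℝ, IsClassicalSolution U c u₀ u₁ T u ∧ (⨆ t ∈ Ico 0 T, size c u t) < ∞}

end QuasilinearWave

end

namespace QuasilinearWave

open Filter Topology
open scoped BoundedContinuousFunction

/-! The proof works in characteristic coordinates. Let `C' = c`, `C 0 = 0`. The Riemann invariants
`r = u_t + C(u_x)` and `s = u_t - C(u_x)` are constant along the characteristics of speed `-c` and
`c` respectively. Label a point by the feet `(a, b)` at time `0` of its two characteristics. Then
`r` depends on `a` alone and `s` on `b` alone, both given by the data, so the slope `v = C⁻¹((r a -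
s b) / 2)` and the speed `L = c(v)` are known functions of the labels. Only the map `(a, b) ↦ (t,
x)` is unknown, and its equations are linear: with `P = x_a = L t_a` and `Q = x_b = -L t_b`,
integrability of `t` and `x` says `P_b = Q_a = (L_b P + L_a Q) / (2L)`, with `P = Q = 1/2` on the
diagonal, which is `t = 0`.

Let `κ` bound `L_a` and `L_b`. If `κT` is small, `P` and `Q` stay within `1/100` of `1/2`
(`exists_goursat`). The label map is then uniformly close to a linear isomorphism on the strip `|a -
b| < 9T`, hence invertible over `|t| < T` (`exists_labels`), and `u` is the potential of `u_t dt +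
u_x dx` (`exists_potential`). Thus the lifespan is at least `T` as soon as `1800 κ T ≤ 1`
(`RiemannData.le_lifespan`).

For data of size `ε`, both `v` and its label derivatives are `O(ε)`. If `|c'(θ)| ≤ K|θ|^q` near `0`,
then `L_a = c'(v) v_a` and `L_b` are `O(ε^(q+1))`, which allows `T` of order `ε^(-(q+1))`
(`exists_le_lifespan`). Part (a) is `q = p - 2`, where flatness is integrated down to `c'`; part (b)
is `q = 0`. -/

/-! ### The linear Goursat problem near the diagonal -/

/-- The point of `[a - W, a + W]` nearest to `b`. -/
noncomputable def clampAround (W a b : ℝ) : ℝ := max (a - W) (min b (a + W))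

lemma abs_clampAround_sub_le {W : ℝ} (hW : 0 ≤ W) (a b : ℝ) : |clampAround W a b - a| ≤ W := by
  unfold clampAround
  rw [abs_le]
  constructor
  · linarith [le_max_left (a - W) (min b (a + W))]
  · have : max (a - W) (min b (a + W)) ≤ a + W := max_le (by linarith) (min_le_right _ _)
    linarith

lemma clampAround_eq {W a b : ℝ} (h : |a - b| ≤ W) : clampAround W a b = b := by
  unfold clampAround
  rw [abs_le] at h
  rw [min_eq_left (by linarith), max_eq_right (by linarith)]

lemma continuous_clampAround (W : ℝ) : Continuous fun z : ℝ × ℝ => clampAround W z.1 z.2 := by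
  unfold clampAround; fun_prop

lemma continuous_intervalIntegral_between {X : Type*} [TopologicalSpace X]
    [FirstCountableTopology X] {f : X → ℝ → ℝ} (hf : Continuous f.uncurry) {s t : X → ℝ}
    (hs : Continuous s) (ht : Continuous t) : Continuous fun x => ∫ y in s x..t x, f x y := by
  have hc : ∀ x, Continuous (f x) := fun x => hf.comp (by fun_prop : Continuous fun y => (x, y))
  have : (fun x => ∫ y in s x..t x, f x y) =
      fun x => (∫ y in (0 : ℝ)..t x, f x y) - ∫ y in (0 : ℝ)..s x, f x y := by
    ext x
    rw [intervalIntegral.integral_interval_sub_left ((hc x).intervalIntegrable _ _)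
      ((hc x).intervalIntegrable _ _)]
  rw [this]
  exact (intervalIntegral.continuous_parametric_intervalIntegral_of_continuous hf ht).sub
    (intervalIntegral.continuous_parametric_intervalIntegral_of_continuous hf hs)

/-- The unknown is the common mixed derivative `G = P_b = Q_a`; integrating it from the diagonal
recovers `P` and `Q`. Clamping the integration length to `W` makes the equation meaningful on the
whole plane, so that Banach's theorem applies to bounded continuous functions, with factor `2κW`. -/
lemma exists_fixedPoint_mixedDerivative {m n : ℝ → ℝ → ℝ} (hm : Continuous fun z : ℝ × ℝ => m z.1 z.2)
    (hn : Continuous fun z : ℝ × ℝ => n z.1 z.2) {κ W : ℝ} (hW : 0 ≤ W)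
    (hmκ : ∀ a b, |m a b| ≤ κ) (hnκ : ∀ a b, |n a b| ≤ κ) (hκW : 2 * κ * W ≤ 1 / 100) :
    ∃ G : ℝ → ℝ → ℝ, (Continuous fun z : ℝ × ℝ => G z.1 z.2) ∧ (∀ a b, |G a b| ≤ 2 * κ) ∧
      ∀ a b, G a b = m a b * (1 / 2 + ∫ y in a..clampAround W a b, G a y) +
        n a b * (1 / 2 + ∫ y in b..clampAround W b a, G y b) := by
  have hκ : 0 ≤ κ := (abs_nonneg _).trans (hmκ 0 0)
  let T : ((ℝ × ℝ) →ᵇ ℝ) → ℝ × ℝ → ℝ := fun G z =>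
    m z.1 z.2 * (1 / 2 + ∫ y in z.1..clampAround W z.1 z.2, G (z.1, y)) +
        n z.1 z.2 * (1 / 2 + ∫ y in z.2..clampAround W z.2 z.1, G (y, z.2))
  have hTc : ∀ G, Continuous (T G) := by
    intro G
    have h1 := continuous_intervalIntegral_between (X := ℝ × ℝ) (f := fun z y => G (z.1, y))
      (by fun_prop) continuous_fst (continuous_clampAround W)
    have h2 := continuous_intervalIntegral_between (X := ℝ × ℝ) (f := fun z y => G (y, z.2))
      (by fun_prop) continuous_snd ((continuous_clampAround W).comp continuous_swap)
    exact (hm.mul (continuous_const.add h1)).add (hn.mul (continuous_const.add h2))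
  have hI : ∀ (g : ℝ → ℝ) (B : ℝ), (∀ y, |g y| ≤ B) → ∀ a b,
      |∫ y in a..clampAround W a b, g y| ≤ B * W := by
    intro g B hg a b
    have := intervalIntegral.norm_integral_le_of_norm_le_const (a := a) (b := clampAround W a b)
      (f := g) (C := B) (fun y _ => hg y)
    have hB : 0 ≤ B := (abs_nonneg _).trans (hg 0)
    exact this.trans (mul_le_mul_of_nonneg_left (abs_clampAround_sub_le hW a b) hB)
  have hTb : ∀ (G : (ℝ × ℝ) →ᵇ ℝ) (B : ℝ), (∀ z, |G z| ≤ B) → ∀ z, |T G z| ≤ κ + B / 100 := by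
    intro G B hG z
    have hB : 0 ≤ B := (abs_nonneg _).trans (hG 0)
    have e1 := hI (fun y => G (z.1, y)) B (fun y => hG _) z.1 z.2
    have e2 := hI (fun y => G (y, z.2)) B (fun y => hG _) z.2 z.1
    have f : ∀ c I : ℝ, |c| ≤ κ → |I| ≤ B * W → |c * (1 / 2 + I)| ≤ κ * (1 / 2 + B * W) := by
      intro c I hc hI
      rw [abs_mul]
      refine mul_le_mul hc ?_ (abs_nonneg _) hκ
      exact (abs_add_le _ _).trans (add_le_add (by norm_num) hI)
    refine (abs_add_le _ _).trans ((add_le_add (f _ _ (hmκ _ _) e1) (f _ _ (hnκ _ _) e2)).trans ?_)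
    nlinarith
  have hGn : ∀ (G : (ℝ × ℝ) →ᵇ ℝ) z, |G z| ≤ ‖G‖ := fun G z => G.norm_coe_le_norm z
  let S : ((ℝ × ℝ) →ᵇ ℝ) → ((ℝ × ℝ) →ᵇ ℝ) := fun G =>
    BoundedContinuousFunction.ofNormedAddCommGroup (T G) (hTc G) (κ + ‖G‖ / 100)
      (fun z => hTb G ‖G‖ (hGn G) z)
  have hS : ∀ G z, S G z = T G z := fun G z => rfl
  have hcontr : ContractingWith (1 / 100) S := by
    refine ⟨by rw [← NNReal.coe_lt_coe]; norm_num, LipschitzWith.of_dist_le_mul fun G H => ?_⟩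
    rw [BoundedContinuousFunction.dist_le (by positivity)]
    intro z
    have hB : ∀ z, |G z - H z| ≤ dist G H := fun z => G.dist_coe_le_dist z
    have hsub : S G z - S H z =
        m z.1 z.2 * (∫ y in z.1..clampAround W z.1 z.2, (G (z.1, y) - H (z.1, y))) +
        n z.1 z.2 * (∫ y in z.2..clampAround W z.2 z.1, (G (y, z.2) - H (y, z.2))) := by
      rw [intervalIntegral.integral_sub, intervalIntegral.integral_sub, hS, hS]
      · simp only [T]; ring
      all_goals exact Continuous.intervalIntegrable (by fun_prop) _ _
    rw [Real.dist_eq, hsub]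
    have e1 := hI (fun y => G (z.1, y) - H (z.1, y)) _ (fun y => hB _) z.1 z.2
    have e2 := hI (fun y => G (y, z.2) - H (y, z.2)) _ (fun y => hB _) z.2 z.1
    have hd : 0 ≤ dist G H := dist_nonneg
    refine (abs_add_le _ _).trans ?_
    rw [abs_mul, abs_mul]
    have f1 := mul_le_mul (hmκ z.1 z.2) e1 (abs_nonneg _) hκ
    have f2 := mul_le_mul (hnκ z.1 z.2) e2 (abs_nonneg _) hκ
    have : ((1 / 100 : ℝ≥0) : ℝ) = 1 / 100 := by norm_num
    rw [this]
    nlinarith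
  let G := ContractingWith.fixedPoint S hcontr
  have hfix : S G = G := hcontr.fixedPoint_isFixedPt
  refine ⟨fun a b => G (a, b), by fun_prop, ?_, ?_⟩
  -- The fixed point inherits the bound of its image, and `‖G‖ / 100` is absorbed on the left.
  · have hn : ‖G‖ ≤ κ + ‖G‖ / 100 := by
      rw [BoundedContinuousFunction.norm_le (by positivity)]
      intro z
      nth_rewrite 1 [← hfix]
      exact hTb G ‖G‖ (hGn G) z
    intro a b
    have := hGn G (a, b)
    linarith
  · intro a b
    nth_rewrite 1 [← hfix]
    rfl

/-- Solution of the linear Goursat problem `P_b = Q_a = m P + n Q`, `P = Q = 1/2` on the diagonal,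
in a strip around the diagonal. -/
theorem exists_goursat {m n : ℝ → ℝ → ℝ} (hm : Continuous fun z : ℝ × ℝ => m z.1 z.2)
    (hn : Continuous fun z : ℝ × ℝ => n z.1 z.2) {κ W : ℝ} (hW : 0 ≤ W)
    (hmκ : ∀ a b, |m a b| ≤ κ) (hnκ : ∀ a b, |n a b| ≤ κ) (hκW : 2 * κ * W ≤ 1 / 100) :
    ∃ P Q : ℝ → ℝ → ℝ, (Continuous fun z : ℝ × ℝ => P z.1 z.2) ∧
      (Continuous fun z : ℝ × ℝ => Q z.1 z.2) ∧
      (∀ a b, |P a b - 1 / 2| ≤ 1 / 100) ∧ (∀ a b, |Q a b - 1 / 2| ≤ 1 / 100) ∧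
      (∀ a, P a a = 1 / 2) ∧ (∀ a, Q a a = 1 / 2) ∧
      (∀ a b, |a - b| < W → HasDerivAt (fun y => P a y) (m a b * P a b + n a b * Q a b) b) ∧
      (∀ a b, |a - b| < W → HasDerivAt (fun y => Q y b) (m a b * P a b + n a b * Q a b) a) := by
  obtain ⟨G, hG, hGb, hGe⟩ := exists_fixedPoint_mixedDerivative hm hn hW hmκ hnκ hκW
  have hG1 : ∀ a, Continuous fun y => G a y := fun a =>
    hG.comp (by fun_prop : Continuous fun y : ℝ => (a, y))
  have hG2 : ∀ b, Continuous fun y => G y b := fun b =>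
    hG.comp (by fun_prop : Continuous fun y : ℝ => (y, b))
  have hI : ∀ (g : ℝ → ℝ), (∀ y, |g y| ≤ 2 * κ) → ∀ a b,
      |1 / 2 + (∫ y in a..clampAround W a b, g y) - 1 / 2| ≤ 1 / 100 := by
    intro g hg a b
    have := intervalIntegral.norm_integral_le_of_norm_le_const (a := a) (b := clampAround W a b)
      (f := g) (C := 2 * κ) (fun y _ => hg y)
    have hB : 0 ≤ 2 * κ := (abs_nonneg _).trans (hg 0)
    rw [add_sub_cancel_left]
    exact (this.trans (mul_le_mul_of_nonneg_left (abs_clampAround_sub_le hW a b) hB)).trans hκW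
  refine ⟨fun a b => 1 / 2 + ∫ y in a..clampAround W a b, G a y,
    fun a b => 1 / 2 + ∫ y in b..clampAround W b a, G y b, ?_, ?_, ?_, ?_, ?_, ?_, ?_, ?_⟩
  · exact continuous_const.add (continuous_intervalIntegral_between (X := ℝ × ℝ)
      (f := fun z y => G z.1 y) (hG.comp (by fun_prop : Continuous fun z : (ℝ × ℝ) × ℝ => (z.1.1, z.2)))
      continuous_fst (continuous_clampAround W))
  · exact continuous_const.add (continuous_intervalIntegral_between (X := ℝ × ℝ)
      (f := fun z y => G y z.2) (hG.comp (by fun_prop : Continuous fun z : (ℝ × ℝ) × ℝ => (z.2, z.1.2)))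
      continuous_snd ((continuous_clampAround W).comp continuous_swap))
  · exact fun a b => hI _ (fun y => hGb a y) a b
  · exact fun a b => hI _ (fun y => hGb y b) b a
  · intro a; simp [clampAround_eq (W := W) (a := a) (b := a) (by simpa using hW)]
  · intro a; simp [clampAround_eq (W := W) (a := a) (b := a) (by simpa using hW)]
  · intro a b hab
    dsimp only
    rw [← hGe a b]
    have h := ((hG1 a).integral_hasStrictDerivAt a b).hasDerivAt.const_add (1 / 2)
    refine h.congr_of_eventuallyEq ?_
    -- Inside the strip the clamp is locally inactive, so the fundamental theorem of calculus
    -- applies.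
    have : ∀ᶠ y in 𝓝 b, |a - y| < W :=
      (show Continuous fun y : ℝ => |a - y| by fun_prop).continuousAt.eventually_lt_const hab
    filter_upwards [this] with y hy
    rw [clampAround_eq hy.le]
  · intro a b hab
    dsimp only
    rw [← hGe a b]
    have h := ((hG2 b).integral_hasStrictDerivAt b a).hasDerivAt.const_add (1 / 2)
    refine h.congr_of_eventuallyEq ?_
    have : ∀ᶠ y in 𝓝 a, |y - b| < W :=
      (show Continuous fun y : ℝ => |y - b| by fun_prop).continuousAt.eventually_lt_const hab
    filter_upwards [this] with y hy
    rw [clampAround_eq (by rw [abs_sub_comm]; exact hy.le)]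

/-! ### Potentials of closed differential forms -/

lemma hasFDerivAt_of_continuous_partials {f fa fb : ℝ → ℝ → ℝ}
    (ha : ∀ a b, HasDerivAt (fun y => f y b) (fa a b) a)
    (hb : ∀ a b, HasDerivAt (fun y => f a y) (fb a b) b)
    (ca : Continuous fun z : ℝ × ℝ => fa z.1 z.2) (cb : Continuous fun z : ℝ × ℝ => fb z.1 z.2)
    (z : ℝ × ℝ) :
    HasFDerivAt (fun z : ℝ × ℝ => f z.1 z.2) (fa z.1 z.2 • ContinuousLinearMap.fst ℝ ℝ ℝ +
        fb z.1 z.2 • ContinuousLinearMap.snd ℝ ℝ ℝ) z := by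
  have key := hasStrictFDerivAt_uncurry_coprod (𝕜 := ℝ) (u := z) (f := f)
    (f₁ := fun a b => ContinuousLinearMap.toSpanSingleton ℝ (fa a b))
    (f₂ := fun a b => ContinuousLinearMap.toSpanSingleton ℝ (fb a b))
    (Eventually.of_forall fun v => (ha v.1 v.2).hasFDerivAt)
    (Eventually.of_forall fun v => (hb v.1 v.2).hasFDerivAt)
    ((ContinuousLinearMap.toSpanSingletonCLE (𝕜 := ℝ) (E := ℝ)).continuous.comp ca).continuousAt
    ((ContinuousLinearMap.toSpanSingletonCLE (𝕜 := ℝ) (E := ℝ)).continuous.comp cb).continuousAt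
  refine HasFDerivAt.congr_fderiv (f := fun z : ℝ × ℝ => f z.1 z.2) key.hasFDerivAt ?_
  ext <;> simp [Function.HasUncurry.uncurry]

/-- A continuous function on the plane is the mixed derivative of a differentiable function. -/
lemma hasFDerivAt_iteratedIntegral {G : ℝ → ℝ → ℝ} (hG : Continuous fun z : ℝ × ℝ => G z.1 z.2)
    (z : ℝ × ℝ) :
    HasFDerivAt (fun z : ℝ × ℝ => ∫ x in (0 : ℝ)..z.1, ∫ y in (0 : ℝ)..z.2, G x y)
      ((∫ y in (0 : ℝ)..z.2, G z.1 y) • ContinuousLinearMap.fst ℝ ℝ ℝ +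
        (∫ x in (0 : ℝ)..z.1, G x z.2) • ContinuousLinearMap.snd ℝ ℝ ℝ) z := by
  have c1 : Continuous fun z : ℝ × ℝ => ∫ y in (0 : ℝ)..z.2, G z.1 y :=
    continuous_intervalIntegral_between (X := ℝ × ℝ) (f := fun z y => G z.1 y)
      (hG.comp (by fun_prop : Continuous fun z : (ℝ × ℝ) × ℝ => (z.1.1, z.2)))
      continuous_const continuous_snd
  have c2 : Continuous fun z : ℝ × ℝ => ∫ x in (0 : ℝ)..z.1, G x z.2 :=
    continuous_intervalIntegral_between (X := ℝ × ℝ) (f := fun z y => G y z.2)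
      (hG.comp (by fun_prop : Continuous fun z : (ℝ × ℝ) × ℝ => (z.2, z.1.2)))
      continuous_const continuous_fst
  refine hasFDerivAt_of_continuous_partials
    (f := fun a b => ∫ x in (0 : ℝ)..a, ∫ y in (0 : ℝ)..b, G x y)
    (fa := fun a b => ∫ y in (0 : ℝ)..b, G a y) (fb := fun a b => ∫ x in (0 : ℝ)..a, G x b)
    (fun a b => ?_) (fun a b => ?_) c1 c2 z
  · have : Continuous fun x => ∫ y in (0 : ℝ)..b, G x y :=
      c1.comp (by fun_prop : Continuous fun x : ℝ => (x, b))
    exact (this.integral_hasStrictDerivAt 0 a).hasDerivAt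
  · have : Continuous fun y => ∫ x in (0 : ℝ)..a, G x y :=
      c2.comp (by fun_prop : Continuous fun y : ℝ => (a, y))
    -- Fubini makes `y` the outer variable, so the derivative in `b` is again that of a single
    -- integral.
    refine (this.integral_hasStrictDerivAt 0 b).hasDerivAt.congr_of_eventuallyEq
      (Eventually.of_forall fun b => ?_)
    dsimp only
    refine intervalIntegral_intervalIntegral_swap ?_
    refine IntegrableOn.mono_set (t := uIcc 0 a ×ˢ uIcc 0 b) ?_
      (prod_mono uIoc_subset_uIcc uIoc_subset_uIcc)
    exact hG.continuousOn.integrableOn_compact (isCompact_uIcc.prod isCompact_uIcc)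

lemma eq_add_integral_of_hasDerivAt {f g : ℝ → ℝ} (hg : Continuous g) {a b : ℝ}
    (h : ∀ y ∈ uIcc a b, HasDerivAt f (g y) y) : f b = f a + ∫ y in a..b, g y := by
  rw [intervalIntegral.integral_eq_sub_of_hasDerivAt h (hg.intervalIntegrable _ _)]; ring

/-- A differential form `P da + Q db` with `P_b = Q_a` in a strip around the diagonal has a potential there,
with given values on the diagonal. -/
theorem exists_potential {P Q G : ℝ → ℝ → ℝ} {W : ℝ} (hW : 0 < W)
    (hP : Continuous fun z : ℝ × ℝ => P z.1 z.2) (hQ : Continuous fun z : ℝ × ℝ => Q z.1 z.2)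
    (hG : Continuous fun z : ℝ × ℝ => G z.1 z.2)
    (hPG : ∀ a b, |a - b| < W → HasDerivAt (fun y => P a y) (G a b) b)
    (hQG : ∀ a b, |a - b| < W → HasDerivAt (fun y => Q y b) (G a b) a)
    {F₀ : ℝ → ℝ} (hF₀ : ∀ a, HasDerivAt F₀ (P a a + Q a a) a) :
    ∃ F : ℝ × ℝ → ℝ, (∀ a, F (a, a) = F₀ a) ∧ ∀ z : ℝ × ℝ, |z.1 - z.2| < W →
      HasFDerivAt F (P z.1 z.2 • ContinuousLinearMap.fst ℝ ℝ ℝ +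
        Q z.1 z.2 • ContinuousLinearMap.snd ℝ ℝ ℝ) z := by
  have hG1 : ∀ a, Continuous fun y => G a y := fun a =>
    hG.comp (by fun_prop : Continuous fun y : ℝ => (a, y))
  have hG2 : ∀ b, Continuous fun y => G y b := fun b =>
    hG.comp (by fun_prop : Continuous fun y : ℝ => (y, b))
  -- The rectangle from the origin to `(a, b)` may leave the strip, where `G` has no meaning. The
  -- corrections `p` and `q` cancel this: `p a + ∫₀ᵇ G a y = P a a + ∫ₐᵇ G a y`, which only involves
  -- the strip.
  let p : ℝ → ℝ := fun a => P a a - ∫ y in (0 : ℝ)..a, G a y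
  let q : ℝ → ℝ := fun b => Q b b - ∫ x in (0 : ℝ)..b, G x b
  have hp : Continuous p := (hP.comp (by fun_prop : Continuous fun a : ℝ => (a, a))).sub
    (continuous_intervalIntegral_between (X := ℝ) (f := fun a y => G a y) hG continuous_const
      continuous_id)
  have hq : Continuous q := (hQ.comp (by fun_prop : Continuous fun a : ℝ => (a, a))).sub
    (continuous_intervalIntegral_between (X := ℝ) (f := fun a y => G y a)
      (hG.comp continuous_swap) continuous_const continuous_id)
  let F : ℝ × ℝ → ℝ := fun z => F₀ 0 + ((∫ x in (0 : ℝ)..z.1, p x) + (∫ y in (0 : ℝ)..z.2, q y) +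
      ∫ x in (0 : ℝ)..z.1, ∫ y in (0 : ℝ)..z.2, G x y)
  have hF : ∀ z : ℝ × ℝ, HasFDerivAt F
      ((p z.1 + ∫ y in (0 : ℝ)..z.2, G z.1 y) • ContinuousLinearMap.fst ℝ ℝ ℝ +
        (q z.2 + ∫ x in (0 : ℝ)..z.1, G x z.2) • ContinuousLinearMap.snd ℝ ℝ ℝ) z := by
    intro z
    have h1 := (hp.integral_hasStrictDerivAt 0 z.1).hasDerivAt.comp_hasFDerivAt z
      (hasFDerivAt_fst (𝕜 := ℝ) (p := z))
    have h2 := (hq.integral_hasStrictDerivAt 0 z.2).hasDerivAt.comp_hasFDerivAt z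
      (hasFDerivAt_snd (𝕜 := ℝ) (p := z))
    have := ((h1.add h2).add (hasFDerivAt_iteratedIntegral hG z)).const_add (F₀ 0)
    refine this.congr_fderiv ?_
    ext <;> simp
  have hPe : ∀ a b, |a - b| < W → p a + (∫ y in (0 : ℝ)..b, G a y) = P a b := by
    intro a b hab
    rw [eq_add_integral_of_hasDerivAt (f := fun y => P a y) (a := a) (b := b) (hG1 a)]
    · simp only [p]
      rw [← intervalIntegral.integral_add_adjacent_intervals
        ((hG1 a).intervalIntegrable 0 a) ((hG1 a).intervalIntegrable a b)]
      ring
    · intro y hy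
      refine hPG a y ?_
      have := abs_sub_left_of_mem_uIcc hy
      rw [abs_sub_comm] at this
      refine this.trans_lt ?_
      rwa [abs_sub_comm]
  have hQe : ∀ a b, |a - b| < W → q b + (∫ y in (0 : ℝ)..a, G y b) = Q a b := by
    intro a b hab
    rw [eq_add_integral_of_hasDerivAt (f := fun y => Q y b) (a := b) (b := a) (hG2 b)]
    · simp only [q]
      rw [← intervalIntegral.integral_add_adjacent_intervals
        ((hG2 b).intervalIntegrable 0 b) ((hG2 b).intervalIntegrable b a)]
      ring
    · intro y hy
      refine hQG y b ?_
      have := abs_sub_left_of_mem_uIcc hy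
      exact this.trans_lt hab
  have hF' : ∀ z : ℝ × ℝ, |z.1 - z.2| < W →
      HasFDerivAt F (P z.1 z.2 • ContinuousLinearMap.fst ℝ ℝ ℝ +
        Q z.1 z.2 • ContinuousLinearMap.snd ℝ ℝ ℝ) z := by
    intro z hz
    have := hF z
    rwa [hPe _ _ hz, hQe _ _ hz] at this
  refine ⟨F, fun a => ?_, hF'⟩
  -- Along the diagonal both functions have derivative `P a a + Q a a`, and they agree at `0`.
  have hd : ∀ a, HasDerivAt (fun a => F (a, a) - F₀ a) 0 a := by
    intro a
    have h1 := HasFDerivAt.comp_hasDerivAt (f := fun a : ℝ => (a, a)) a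
      (hF' (a, a) (by simpa using hW)) ((hasDerivAt_id' a).prodMk (hasDerivAt_id' a))
    exact (h1.sub (hF₀ a)).congr_deriv (by simp)
  have h0 : F (a, a) - F₀ a = F (0, 0) - F₀ 0 :=
    is_const_of_deriv_eq_zero (f := fun a => F (a, a) - F₀ a)
      (fun a => (hd a).differentiableAt) (fun a => (hd a).deriv) a 0
  have h00 : F (0, 0) = F₀ 0 := by simp [F]
  rw [h00] at h0
  linarith

/-! ### Characteristic labels and their inversion -/

/-- Data of the quasilinear wave equation in characteristic labels `(a, b)`: the Riemann invariants
are `r a` and `s b`, the solution has slope `v a b` and velocity `(r a + s b) / 2`, and the wave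
speed is `L a b`, with partial derivatives `La`, `Lb`. -/
structure RiemannData (r s r' s' : ℝ → ℝ) (L v La Lb : ℝ → ℝ → ℝ) (κ : ℝ) : Prop where
  hasDerivAt_r : ∀ a, HasDerivAt r (r' a) a
  hasDerivAt_s : ∀ b, HasDerivAt s (s' b) b
  continuous_r' : Continuous r'
  continuous_s' : Continuous s'
  continuous_L : Continuous fun z : ℝ × ℝ => L z.1 z.2
  continuous_v : Continuous fun z : ℝ × ℝ => v z.1 z.2
  continuous_La : Continuous fun z : ℝ × ℝ => La z.1 z.2
  continuous_Lb : Continuous fun z : ℝ × ℝ => Lb z.1 z.2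
  hasDerivAt_La : ∀ a b, HasDerivAt (fun y => L y b) (La a b) a
  hasDerivAt_Lb : ∀ a b, HasDerivAt (fun y => L a y) (Lb a b) b
  hasDerivAt_va : ∀ a b, HasDerivAt (fun y => v y b) (r' a / (2 * L a b)) a
  hasDerivAt_vb : ∀ a b, HasDerivAt (fun y => v a y) (-s' b / (2 * L a b)) b
  abs_L_sub_one_le : ∀ a b, |L a b - 1| ≤ 1 / 100
  abs_La_le : ∀ a b, |La a b| ≤ κ
  abs_Lb_le : ∀ a b, |Lb a b| ≤ κ

/-- The differential of `(t, x)` with respect to characteristic labels, as an invertible map: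
`t_a = p / l`, `t_b = -q / l`, `x_a = p`, `x_b = q`. -/
noncomputable def labelEquiv (p q l : ℝ) (hp : p ≠ 0) (hq : q ≠ 0) (hl : l ≠ 0) :
    (ℝ × ℝ) ≃L[ℝ] (ℝ × ℝ) :=
  ContinuousLinearEquiv.equivOfInverse
    (((p / l) • ContinuousLinearMap.fst ℝ ℝ ℝ + (-q / l) • ContinuousLinearMap.snd ℝ ℝ ℝ).prod
      (p • ContinuousLinearMap.fst ℝ ℝ ℝ + q • ContinuousLinearMap.snd ℝ ℝ ℝ))
    (((l / (2 * p)) • ContinuousLinearMap.fst ℝ ℝ ℝ +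
        (1 / (2 * p)) • ContinuousLinearMap.snd ℝ ℝ ℝ).prod
      ((-l / (2 * q)) • ContinuousLinearMap.fst ℝ ℝ ℝ +
        (1 / (2 * q)) • ContinuousLinearMap.snd ℝ ℝ ℝ))
    (fun z => by ext <;> simp <;> field_simp <;> ring)
    (fun z => by ext <;> simp <;> field_simp <;> ring)

lemma labelEquiv_coe (p q l : ℝ) (hp : p ≠ 0) (hq : q ≠ 0) (hl : l ≠ 0) :
    (labelEquiv p q l hp hq hl : (ℝ × ℝ) →L[ℝ] (ℝ × ℝ)) =
    (((p / l) • ContinuousLinearMap.fst ℝ ℝ ℝ + (-q / l) • ContinuousLinearMap.snd ℝ ℝ ℝ).prod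
      (p • ContinuousLinearMap.fst ℝ ℝ ℝ + q • ContinuousLinearMap.snd ℝ ℝ ℝ)) := rfl

lemma labelEquiv_symm_coe (p q l : ℝ) (hp : p ≠ 0) (hq : q ≠ 0) (hl : l ≠ 0) :
    ((labelEquiv p q l hp hq hl).symm : (ℝ × ℝ) →L[ℝ] (ℝ × ℝ)) =
    (((l / (2 * p)) • ContinuousLinearMap.fst ℝ ℝ ℝ +
        (1 / (2 * p)) • ContinuousLinearMap.snd ℝ ℝ ℝ).prod
      ((-l / (2 * q)) • ContinuousLinearMap.fst ℝ ℝ ℝ +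
        (1 / (2 * q)) • ContinuousLinearMap.snd ℝ ℝ ℝ)) := rfl

/-- The model inverse is `(t, x) ↦ (x + t, x - t)`. Its norm bound tells how large a perturbation of
the model remains invertible. -/
lemma norm_labelEquiv_half_symm_le :
    ‖((labelEquiv (1 / 2) (1 / 2) 1 (by norm_num) (by norm_num) one_ne_zero).symm :
      (ℝ × ℝ) →L[ℝ] (ℝ × ℝ))‖₊ ≤ 2 := by
  rw [← NNReal.coe_le_coe, coe_nnnorm]
  refine ContinuousLinearMap.opNorm_le_bound _ (by norm_num) fun z => ?_
  have h1 : |z.1| ≤ ‖z‖ := norm_fst_le z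
  have h2 : |z.2| ≤ ‖z‖ := norm_snd_le z
  rw [labelEquiv_symm_coe, Prod.norm_def]
  rw [abs_le] at h1 h2
  refine max_le ?_ ?_ <;> simp only [ContinuousLinearMap.prod_apply, add_apply,
    smul_apply, ContinuousLinearMap.coe_fst', ContinuousLinearMap.coe_snd',
    smul_eq_mul, Real.norm_eq_abs, abs_le, NNReal.coe_ofNat] <;> constructor <;> linarith

lemma norm_labelMap_sub_half_le {p q l : ℝ} (hp : |p - 1 / 2| ≤ 1 / 100) (hq : |q - 1 / 2| ≤ 1 / 100)
    (hl : |l - 1| ≤ 1 / 100) :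
    ‖((p / l) • ContinuousLinearMap.fst ℝ ℝ ℝ + (-q / l) • ContinuousLinearMap.snd ℝ ℝ ℝ).prod
      (p • ContinuousLinearMap.fst ℝ ℝ ℝ + q • ContinuousLinearMap.snd ℝ ℝ ℝ) -
      (labelEquiv (1 / 2) (1 / 2) 1 (by norm_num) (by norm_num) one_ne_zero :
        (ℝ × ℝ) →L[ℝ] (ℝ × ℝ))‖ ≤ 1 / 25 := by
  have hl' := abs_le.1 hl
  have hl0 : 0 < l := by linarith
  have hdiv : ∀ p : ℝ, |p - 1 / 2| ≤ 1 / 100 → |p / l - 1 / 2| ≤ 1 / 50 := by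
    intro p hp
    have hp' := abs_le.1 hp
    rw [abs_le]
    constructor
    · rw [neg_le_sub_iff_le_add, ← sub_le_iff_le_add, le_div_iff₀ hl0]; linarith
    · rw [sub_le_iff_le_add, div_le_iff₀ hl0]; linarith
  refine ContinuousLinearMap.opNorm_le_bound _ (by norm_num) fun z => ?_
  have h1 : |z.1| ≤ ‖z‖ := norm_fst_le z
  have h2 : |z.2| ≤ ‖z‖ := norm_snd_le z
  have hz : 0 ≤ ‖z‖ := norm_nonneg z
  have est : ∀ c d : ℝ, |c| ≤ 1 / 50 → |d| ≤ 1 / 50 → |c * z.1 + d * z.2| ≤ 1 / 25 * ‖z‖ := by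
    intro c d hc hd
    refine (abs_add_le _ _).trans ?_
    rw [abs_mul, abs_mul]
    have e1 := mul_le_mul hc h1 (abs_nonneg _) (by norm_num)
    have e2 := mul_le_mul hd h2 (abs_nonneg _) (by norm_num)
    linarith
  rw [labelEquiv_coe, Prod.norm_def]
  refine max_le ?_ ?_
  · have := est (p / l - 1 / 2) (-(q / l - 1 / 2)) (hdiv p hp) (by rw [abs_neg]; exact hdiv q hq)
    refine le_of_eq_of_le (congrArg _ ?_) this
    simp
    ring
  · have := est (p - 1 / 2) (q - 1 / 2) (hp.trans (by norm_num)) (hq.trans (by norm_num))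
    refine le_of_eq_of_le (congrArg _ ?_) this
    simp
    ring

/-- Global inversion of a map close to the linear model, on a strip around the diagonal. -/
theorem exists_labels {P Q L : ℝ → ℝ → ℝ} {T : ℝ} (hT : 0 < T) {t x : ℝ × ℝ → ℝ}
    (hP : ∀ a b, |P a b - 1 / 2| ≤ 1 / 100) (hQ : ∀ a b, |Q a b - 1 / 2| ≤ 1 / 100)
    (hL : ∀ a b, |L a b - 1| ≤ 1 / 100)
    (ht : ∀ z : ℝ × ℝ, |z.1 - z.2| < 9 * T →
      HasFDerivAt t ((P z.1 z.2 / L z.1 z.2) • ContinuousLinearMap.fst ℝ ℝ ℝ +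
        (-Q z.1 z.2 / L z.1 z.2) • ContinuousLinearMap.snd ℝ ℝ ℝ) z)
    (hx : ∀ z : ℝ × ℝ, |z.1 - z.2| < 9 * T →
      HasFDerivAt x (P z.1 z.2 • ContinuousLinearMap.fst ℝ ℝ ℝ +
        Q z.1 z.2 • ContinuousLinearMap.snd ℝ ℝ ℝ) z)
    (ht0 : ∀ a, t (a, a) = 0) (hx0 : ∀ a, x (a, a) = a) :
    ∃ Z : ℝ × ℝ → ℝ × ℝ, (∀ y, Z (0, y) = (y, y)) ∧ ∀ q : ℝ × ℝ, |q.1| < T →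
      |(Z q).1 - (Z q).2| < 9 * T ∧
      HasFDerivAt Z (((L (Z q).1 (Z q).2 / (2 * P (Z q).1 (Z q).2)) • ContinuousLinearMap.fst ℝ ℝ ℝ +
        (1 / (2 * P (Z q).1 (Z q).2)) • ContinuousLinearMap.snd ℝ ℝ ℝ).prod
      ((-L (Z q).1 (Z q).2 / (2 * Q (Z q).1 (Z q).2)) • ContinuousLinearMap.fst ℝ ℝ ℝ +
        (1 / (2 * Q (Z q).1 (Z q).2)) • ContinuousLinearMap.snd ℝ ℝ ℝ)) q := by
  let S : Set (ℝ × ℝ) := {z | |z.1 - z.2| < 9 * T}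
  have hSo : IsOpen S := isOpen_lt (by fun_prop) continuous_const
  have hSc : Convex ℝ S := by
    have : S = (ContinuousLinearMap.fst ℝ ℝ ℝ - ContinuousLinearMap.snd ℝ ℝ ℝ) ⁻¹'
        Ioo (-(9 * T)) (9 * T) := by
      ext z; simp [S, abs_lt]
    rw [this]
    exact (convex_Ioo _ _).linear_preimage
      (ContinuousLinearMap.fst ℝ ℝ ℝ - ContinuousLinearMap.snd ℝ ℝ ℝ).toLinearMap
  let Φ : ℝ × ℝ → ℝ × ℝ := fun z => (t z, x z)
  have hΦ : ∀ z ∈ S, HasFDerivAt Φ _ z := fun z hz => (ht z hz).prodMk (hx z hz)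
  let E := labelEquiv (1 / 2) (1 / 2) 1 (by norm_num) (by norm_num) one_ne_zero
  have happ : ApproximatesLinearOn Φ (E : (ℝ × ℝ) →L[ℝ] (ℝ × ℝ)) S (1 / 25) := by
    intro z hz y hy
    have := hSc.norm_image_sub_le_of_norm_hasFDerivWithin_le' (f := Φ) (C := 1 / 25)
      (φ := (E : (ℝ × ℝ) →L[ℝ] (ℝ × ℝ)))
      (fun z hz => (hΦ z hz).hasFDerivWithinAt)
      (fun z hz => norm_labelMap_sub_half_le (hP _ _) (hQ _ _) (hL _ _)) hy hz
    exact this.trans (by norm_num)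
  have hN := norm_labelEquiv_half_symm_le
  have hNpos : 0 < ‖(E.symm : (ℝ × ℝ) →L[ℝ] (ℝ × ℝ))‖₊ := E.subsingleton_or_nnnorm_symm_pos.resolve_left
    (fun h => absurd (@Subsingleton.elim _ h ((0 : ℝ), (0 : ℝ)) (1, 0)) (by simp))
  have hNinv : (1 / 2 : ℝ≥0) ≤ ‖(E.symm : (ℝ × ℝ) →L[ℝ] (ℝ × ℝ))‖₊⁻¹ := by
    rw [one_div]; exact inv_anti₀ hNpos hN
  -- The perturbation `1/25` is below `1/2`, a lower bound for the inverse norm of the model's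
  -- inverse.
  have hc : Subsingleton (ℝ × ℝ) ∨ (1 / 25 : ℝ≥0) < ‖(E.symm : (ℝ × ℝ) →L[ℝ] (ℝ × ℝ))‖₊⁻¹ :=
    Or.inr (lt_of_lt_of_le (by rw [← NNReal.coe_lt_coe]; norm_num) hNinv)
  let H := happ.toOpenPartialHomeomorph Φ S hc hSo
  have hHΦ : ∀ z, H z = Φ z := fun z => rfl
  refine ⟨H.symm, fun y => ?_, fun q hq => ?_⟩
  · have hy : (y, y) ∈ H.source := by
      change |y - y| < 9 * T
      simpa using hT
    have := H.left_inv hy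
    rwa [hHΦ, show Φ (y, y) = (0, y) by simp [Φ, ht0, hx0]] at this
  -- In this ball `|a - b| ≤ 8T`, and its image covers radius at least `(1/2 - 1/25) · 4T > T` about
  -- `(0, q.2)`, hence reaches `q`.
  · have hball : Metric.closedBall (q.2, q.2) (4 * T) ⊆ S := by
      intro z hz
      rw [Metric.mem_closedBall, Prod.dist_eq, max_le_iff, Real.dist_eq, Real.dist_eq] at hz
      have h1 := abs_le.1 hz.1
      have h2 := abs_le.1 hz.2
      change |z.1 - z.2| < 9 * T
      rw [abs_lt]
      dsimp only at h1 h2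
      constructor <;> linarith
    have htar : q ∈ H.target := by
      refine happ.closedBall_subset_target hc hSo (by positivity) hball ?_
      rw [Metric.mem_closedBall, show Φ (q.2, q.2) = (0, q.2) by simp [Φ, ht0, hx0], Prod.dist_eq,
        dist_self]
      have hN' : (1 / 2 : ℝ) ≤ (‖(E.symm : (ℝ × ℝ) →L[ℝ] (ℝ × ℝ))‖₊⁻¹ : ℝ≥0) := by
        exact_mod_cast NNReal.coe_le_coe.2 hNinv
      have h25 : ((1 / 25 : ℝ≥0) : ℝ) = 1 / 25 := by norm_num
      rw [h25]
      generalize ((‖(E.symm : (ℝ × ℝ) →L[ℝ] (ℝ × ℝ))‖₊⁻¹ : ℝ≥0) : ℝ) = N at hN' ⊢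
      refine max_le ?_ ?_
      · rw [Real.dist_eq, sub_zero]
        nlinarith
      · exact mul_nonneg (by linarith) (by linarith)
    have hZ : H.symm q ∈ S := H.map_target htar
    refine ⟨hZ, ?_⟩
    set z := H.symm q with hz
    have hp0 : P z.1 z.2 ≠ 0 := by
      have := abs_le.1 (hP z.1 z.2); linarith
    have hq0 : Q z.1 z.2 ≠ 0 := by
      have := abs_le.1 (hQ z.1 z.2); linarith
    have hl0 : L z.1 z.2 ≠ 0 := by
      have := abs_le.1 (hL z.1 z.2); linarith
    have hd : HasFDerivAt H (labelEquiv _ _ _ hp0 hq0 hl0 : (ℝ × ℝ) →L[ℝ] (ℝ × ℝ)) (H.symm q) := by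
      rw [labelEquiv_coe]
      exact hΦ z hZ
    have := H.hasFDerivAt_symm htar hd
    rwa [labelEquiv_symm_coe] at this

/-- Solution of the wave equation in characteristic labels. -/
theorem RiemannData.exists_solution {r s r' s' : ℝ → ℝ} {L v La Lb : ℝ → ℝ → ℝ} {κ : ℝ}
    (D : RiemannData r s r' s' L v La Lb κ) {T : ℝ} (hT : 0 < T) (hκT : 1800 * κ * T ≤ 1)
    {F₀ : ℝ → ℝ} (hF₀ : ∀ a, HasDerivAt F₀ (v a a) a) :
    ∃ (P Q : ℝ → ℝ → ℝ) (Z : ℝ × ℝ → ℝ × ℝ) (u : ℝ × ℝ → ℝ),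
      (Continuous fun z : ℝ × ℝ => P z.1 z.2) ∧ (Continuous fun z : ℝ × ℝ => Q z.1 z.2) ∧
      (∀ a b, |P a b - 1 / 2| ≤ 1 / 100) ∧ (∀ a b, |Q a b - 1 / 2| ≤ 1 / 100) ∧
      (∀ y, Z (0, y) = (y, y)) ∧ (∀ y, u (0, y) = F₀ y) ∧ ∀ q : ℝ × ℝ, |q.1| < T →
      HasFDerivAt Z (((L (Z q).1 (Z q).2 / (2 * P (Z q).1 (Z q).2)) • ContinuousLinearMap.fst ℝ ℝ ℝ +
        (1 / (2 * P (Z q).1 (Z q).2)) • ContinuousLinearMap.snd ℝ ℝ ℝ).prod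
      ((-L (Z q).1 (Z q).2 / (2 * Q (Z q).1 (Z q).2)) • ContinuousLinearMap.fst ℝ ℝ ℝ +
        (1 / (2 * Q (Z q).1 (Z q).2)) • ContinuousLinearMap.snd ℝ ℝ ℝ)) q ∧
      HasFDerivAt u (((r (Z q).1 + s (Z q).2) / 2) • ContinuousLinearMap.fst ℝ ℝ ℝ +
        v (Z q).1 (Z q).2 • ContinuousLinearMap.snd ℝ ℝ ℝ) q := by
  have hLpos : ∀ a b, 0 < L a b := fun a b => by
    have := abs_le.1 (D.abs_L_sub_one_le a b); linarith
  have hL0 : ∀ a b, L a b ≠ 0 := fun a b => (hLpos a b).ne'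
  have cL := D.continuous_L
  have cv := D.continuous_v
  have cLa := D.continuous_La
  have cLb := D.continuous_Lb
  have cr : Continuous r := continuous_iff_continuousAt.2 fun a => (D.hasDerivAt_r a).continuousAt
  have cs : Continuous s := continuous_iff_continuousAt.2 fun a => (D.hasDerivAt_s a).continuousAt
  let m : ℝ → ℝ → ℝ := fun a b => Lb a b / (2 * L a b)
  let n : ℝ → ℝ → ℝ := fun a b => La a b / (2 * L a b)
  have cm : Continuous fun z : ℝ × ℝ => m z.1 z.2 :=
    cLb.div (continuous_const.mul cL) fun z => mul_ne_zero two_ne_zero (hL0 _ _)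
  have cn : Continuous fun z : ℝ × ℝ => n z.1 z.2 :=
    cLa.div (continuous_const.mul cL) fun z => mul_ne_zero two_ne_zero (hL0 _ _)
  have hb : ∀ (a b e : ℝ), |e| ≤ κ → |e / (2 * L a b)| ≤ κ := by
    intro a b e he
    have := abs_le.1 (D.abs_L_sub_one_le a b)
    rw [abs_div, abs_of_pos (a := 2 * L a b) (by linarith), div_le_iff₀ (by linarith)]
    nlinarith [abs_nonneg e]
  -- With `W = 9T`, the smallness condition `2κW ≤ 1/100` is exactly `1800 κ T ≤ 1`.
  obtain ⟨P, Q, cP, cQ, hP, hQ, hPd, hQd, hPb, hQa⟩ := exists_goursat cm cn (κ := κ) (W := 9 * T)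
    (by positivity) (fun a b => hb a b _ (D.abs_Lb_le a b)) (fun a b => hb a b _ (D.abs_La_le a b))
    (by nlinarith)
  have hmL : ∀ a b, Lb a b = 2 * L a b * m a b := fun a b => by
    simp only [m]; have := hL0 a b; field_simp
  have hnL : ∀ a b, La a b = 2 * L a b * n a b := fun a b => by
    simp only [n]; have := hL0 a b; field_simp
  obtain ⟨x, hx0, hx⟩ := exists_potential (P := P) (Q := Q)
    (G := fun a b => m a b * P a b + n a b * Q a b) (W := 9 * T) (F₀ := fun a => a)
    (by positivity) cP cQ ((cm.mul cP).add (cn.mul cQ)) hPb hQa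
    (fun a => (hasDerivAt_id' a).congr_deriv (by rw [hPd, hQd]; norm_num))
  obtain ⟨t, ht0, ht⟩ := exists_potential (P := fun a b => P a b / L a b)
    (Q := fun a b => -Q a b / L a b)
    (G := fun a b => (n a b * Q a b - m a b * P a b) / L a b) (W := 9 * T) (F₀ := fun a => 0)
    (by positivity) (cP.div cL fun z => hL0 _ _) (cQ.neg.div cL fun z => hL0 _ _)
    (((cn.mul cQ).sub (cm.mul cP)).div cL fun z => hL0 _ _)
    (fun a b hab => ((hPb a b hab).div (D.hasDerivAt_Lb a b) (hL0 a b)).congr_deriv (by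
      rw [hmL]; have := hL0 a b; field_simp; ring))
    (fun a b hab => ((hQa a b hab).neg.div (D.hasDerivAt_La a b) (hL0 a b)).congr_deriv (by
      rw [hnL]; have := hL0 a b; simp only [Pi.neg_apply]; field_simp; ring))
    (fun a => (hasDerivAt_const a (0 : ℝ)).congr_deriv (by rw [hPd, hQd]; ring))
  have cw : Continuous fun z : ℝ × ℝ => (r z.1 + s z.2) / 2 := by fun_prop
  have cwL : Continuous fun z : ℝ × ℝ => (r z.1 + s z.2) / 2 / L z.1 z.2 :=
    cw.div cL fun z => hL0 _ _
  have hwLb : ∀ a b, HasDerivAt (fun y => (r a + s y) / 2 / L a y)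
      (s' b / (2 * L a b) - (r a + s b) * m a b / L a b) b := fun a b =>
    ((((D.hasDerivAt_s b).const_add (r a)).div_const 2).div (D.hasDerivAt_Lb a b)
      (hL0 a b)).congr_deriv (by rw [hmL]; have := hL0 a b; field_simp)
  have hwLa : ∀ a b, HasDerivAt (fun y => (r y + s b) / 2 / L y b)
      (r' a / (2 * L a b) - (r a + s b) * n a b / L a b) a := fun a b =>
    ((((D.hasDerivAt_r a).add_const (s b)).div_const 2).div (D.hasDerivAt_La a b)
      (hL0 a b)).congr_deriv (by rw [hnL]; have := hL0 a b; field_simp)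
  -- With `w = (r + s) / 2`, this is `w dt + v dx` written in labels: `w t_a + v x_a = (v + w / L)
  -- P` and `w t_b + v x_b = (v - w / L) Q`.
  obtain ⟨U, hU0, hU⟩ := exists_potential
    (P := fun a b => (v a b + (r a + s b) / 2 / L a b) * P a b)
    (Q := fun a b => (v a b - (r a + s b) / 2 / L a b) * Q a b)
    (G := fun a b => (v a b - (r a + s b) / 2 / L a b) * (m a b * P a b) +
      (v a b + (r a + s b) / 2 / L a b) * (n a b * Q a b)) (W := 9 * T) (F₀ := F₀)
    (by positivity) ((cv.add cwL).mul cP) ((cv.sub cwL).mul cQ)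
    (((cv.sub cwL).mul (cm.mul cP)).add ((cv.add cwL).mul (cn.mul cQ)))
    (fun a b hab => (((D.hasDerivAt_vb a b).add (hwLb a b)).mul (hPb a b hab)).congr_deriv (by
      have := hL0 a b; simp only [Pi.add_apply]; field_simp; ring))
    (fun a b hab => (((D.hasDerivAt_va a b).sub (hwLa a b)).mul (hQa a b hab)).congr_deriv (by
      have := hL0 a b; simp only [Pi.sub_apply]; field_simp; ring))
    (fun a => (hF₀ a).congr_deriv (by rw [hPd, hQd]; ring))
  obtain ⟨Z, hZ0, hZ⟩ := exists_labels hT hP hQ D.abs_L_sub_one_le ht hx ht0 hx0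
  refine ⟨P, Q, Z, fun q => U (Z q), cP, cQ, hP, hQ, hZ0, fun y => ?_, fun q hq => ⟨(hZ q hq).2, ?_⟩⟩
  · simp only [hZ0, hU0]
  · have := (hU (Z q) (hZ q hq).1).comp q (hZ q hq).2
    refine HasFDerivAt.congr_fderiv (f := fun q => U (Z q)) this ?_
    have hl := hL0 (Z q).1 (Z q).2
    have hp0 : P (Z q).1 (Z q).2 ≠ 0 := by
      have := abs_le.1 (hP (Z q).1 (Z q).2); linarith
    have hq0 : Q (Z q).1 (Z q).2 ≠ 0 := by
      have := abs_le.1 (hQ (Z q).1 (Z q).2); linarith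
    ext <;> simp <;> field_simp <;> ring

/-! ### From labels to a classical solution -/

lemma dt_congr {f g : ℝ → ℝ → ℝ} {T t x : ℝ} (ht : t ∈ Ico 0 T)
    (h : ∀ s ∈ Ico 0 T, f s x = g s x) : dt f t x = dt g t x := by
  refine EventuallyEq.derivWithin_eq ?_ (h t ht)
  filter_upwards [self_mem_nhdsWithin, mem_nhdsWithin_of_mem_nhds (Iio_mem_nhds ht.2)] with s h1 h2
  exact h s ⟨h1, h2⟩

lemma dx_congr {f g : ℝ → ℝ → ℝ} {t x : ℝ} (h : ∀ y, f t y = g t y) : dx f t x = dx g t x := by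
  simp only [dx, h]

lemma hasDerivAt_time {f : ℝ × ℝ → ℝ} {α β t x : ℝ}
    (h : HasFDerivAt f (α • ContinuousLinearMap.fst ℝ ℝ ℝ + β • ContinuousLinearMap.snd ℝ ℝ ℝ)
      (t, x)) : HasDerivAt (fun s => f (s, x)) α t := by
  have := HasFDerivAt.comp_hasDerivAt (f := fun s : ℝ => (s, x)) t h
    ((hasDerivAt_id' t).prodMk (hasDerivAt_const t x))
  exact this.congr_deriv (by simp)

lemma dt_eq_of_hasFDerivAt {f : ℝ × ℝ → ℝ} {α β t x : ℝ} (ht : 0 ≤ t)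
    (h : HasFDerivAt f (α • ContinuousLinearMap.fst ℝ ℝ ℝ + β • ContinuousLinearMap.snd ℝ ℝ ℝ)
      (t, x)) : dt (fun t x => f (t, x)) t x = α :=
  (hasDerivAt_time h).hasDerivWithinAt.derivWithin (uniqueDiffOn_Ici 0 t ht)

lemma dx_eq_of_hasFDerivAt {f : ℝ × ℝ → ℝ} {α β t x : ℝ}
    (h : HasFDerivAt f (α • ContinuousLinearMap.fst ℝ ℝ ℝ + β • ContinuousLinearMap.snd ℝ ℝ ℝ)
      (t, x)) : dx (fun t x => f (t, x)) t x = β := by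
  have := HasFDerivAt.comp_hasDerivAt (f := fun y : ℝ => (t, y)) x h
    ((hasDerivAt_const x t).prodMk (hasDerivAt_id' x))
  exact (this.congr_deriv (by simp)).deriv

lemma contDiffOn_succ_of_hasFDerivAt {f α β : ℝ × ℝ → ℝ} {D : Set (ℝ × ℝ)} (hD : IsOpen D) (n : ℕ)
    (h : ∀ q ∈ D, HasFDerivAt f (α q • ContinuousLinearMap.fst ℝ ℝ ℝ +
      β q • ContinuousLinearMap.snd ℝ ℝ ℝ) q)
    (hα : ContDiffOn ℝ n α D) (hβ : ContDiffOn ℝ n β D) : ContDiffOn ℝ (n + 1) f D := by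
  rw [contDiffOn_succ_iff_hasFDerivWithinAt_of_uniqueDiffOn hD.uniqueDiffOn]
  exact ⟨fun h => by simp at h, _, (hα.smul contDiffOn_const).add (hβ.smul contDiffOn_const),
    fun q hq => (h q hq).hasFDerivWithinAt⟩

lemma eLpNorm_top_le_of_abs_le {f : ℝ → ℝ} {B : ℝ} (h : ∀ x, |f x| ≤ B) :
    eLpNorm f ∞ volume ≤ ENNReal.ofReal B := by
  rw [eLpNorm_exponent_top]
  exact eLpNormEssSup_le_of_ae_bound (Eventually.of_forall h)

lemma enorm_inv_le_two {a : ℝ} (h : 1 / 2 ≤ a) : ‖a‖ₑ⁻¹ ≤ 2 := by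
  rw [ENNReal.inv_le_iff_inv_le, Real.enorm_eq_ofReal (by linarith)]
  refine le_trans (le_of_eq ?_) (ENNReal.ofReal_le_ofReal h)
  rw [one_div, ENNReal.ofReal_inv_of_pos (by norm_num)]
  simp

/-- The gradient `(w, V)` of `u` is a `C¹` function of the labels, and the inverse label map `Z` has
bounded derivatives since `P` and `Q` stay away from `0`. So second derivatives cannot blow up
before `T`. -/
theorem RiemannData.le_lifespan {r s r' s' : ℝ → ℝ} {L v La Lb : ℝ → ℝ → ℝ} {κ : ℝ}
    (D : RiemannData r s r' s' L v La Lb κ) {T : ℝ} (hT : 0 < T) (hκT : 1800 * κ * T ≤ 1)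
    {U : Set ℝ} {c u₀ u₁ : ℝ → ℝ} (hU : ∀ a b, v a b ∈ U) (hc : ∀ a b, c (v a b) = L a b)
    (hu₀ : ∀ a, HasDerivAt u₀ (v a a) a) (hu₁ : ∀ a, u₁ a = (r a + s a) / 2) {B : ℝ}
    (hr : ∀ a, |r a| ≤ B) (hs : ∀ a, |s a| ≤ B) (hr' : ∀ a, |r' a| ≤ B) (hs' : ∀ a, |s' a| ≤ B)
    (hv : ∀ a b, |v a b| ≤ B) (hu₀B : ∀ a, |u₀ a| ≤ B) :
    ENNReal.ofReal T ≤ lifespan U c u₀ u₁ := by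
  obtain ⟨P, Q, Z, u, cP, cQ, hP, hQ, hZ0, hu0, hZu⟩ := D.exists_solution hT hκT hu₀
  have hB : 0 ≤ B := (abs_nonneg _).trans (hr 0)
  have hLb : ∀ a b, 99 / 100 ≤ L a b ∧ L a b ≤ 101 / 100 := fun a b => by
    have := abs_le.1 (D.abs_L_sub_one_le a b); constructor <;> linarith
  have hPb : ∀ a b, 49 / 100 ≤ P a b := fun a b => by
    have := abs_le.1 (hP a b); linarith
  have hQb : ∀ a b, 49 / 100 ≤ Q a b := fun a b => by
    have := abs_le.1 (hQ a b); linarith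
  have hL0 : ∀ a b, L a b ≠ 0 := fun a b => by linarith [(hLb a b).1]
  have hP0 : ∀ a b, P a b ≠ 0 := fun a b => by linarith [hPb a b]
  have hQ0 : ∀ a b, Q a b ≠ 0 := fun a b => by linarith [hQb a b]
  have cL := D.continuous_L
  have cr := D.continuous_r'
  have cs := D.continuous_s'
  let S : Set (ℝ × ℝ) := {q | |q.1| < T}
  have hSo : IsOpen S := isOpen_lt (by fun_prop) continuous_const
  have cZ : ContinuousOn Z S := fun q hq => (hZu q hq).1.continuousAt.continuousWithinAt
  -- These are `r_x` and `s_x` in labels, because `a_x = 1 / (2P)` and `b_x = 1 / (2Q)`.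
  let rx : ℝ × ℝ → ℝ := fun z => r' z.1 / (2 * P z.1 z.2)
  let sx : ℝ × ℝ → ℝ := fun z => s' z.2 / (2 * Q z.1 z.2)
  have crx : Continuous rx := (cr.comp continuous_fst).div (continuous_const.mul cP)
    fun z => mul_ne_zero two_ne_zero (hP0 _ _)
  have csx : Continuous sx := (cs.comp continuous_snd).div (continuous_const.mul cQ)
    fun z => mul_ne_zero two_ne_zero (hQ0 _ _)
  have hrx : ∀ z, |rx z| ≤ 2 * B := fun z => by
    have h1 := hPb z.1 z.2
    have h2 := hr' z.1
    simp only [rx]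
    rw [abs_div, abs_of_pos (a := 2 * P z.1 z.2) (by linarith), div_le_iff₀ (by linarith)]
    nlinarith
  have hsx : ∀ z, |sx z| ≤ 2 * B := fun z => by
    have h1 := hQb z.1 z.2
    have h2 := hs' z.2
    simp only [sx]
    rw [abs_div, abs_of_pos (a := 2 * Q z.1 z.2) (by linarith), div_le_iff₀ (by linarith)]
    nlinarith
  let w : ℝ × ℝ → ℝ := fun q => (r (Z q).1 + s (Z q).2) / 2
  let V : ℝ × ℝ → ℝ := fun q => v (Z q).1 (Z q).2
  let wt : ℝ × ℝ → ℝ := fun q => L (Z q).1 (Z q).2 * (rx (Z q) - sx (Z q)) / 2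
  let wx : ℝ × ℝ → ℝ := fun q => (rx (Z q) + sx (Z q)) / 2
  let vx : ℝ × ℝ → ℝ := fun q => (rx (Z q) - sx (Z q)) / (2 * L (Z q).1 (Z q).2)
  have hu : ∀ q ∈ S, HasFDerivAt u (w q • ContinuousLinearMap.fst ℝ ℝ ℝ +
      V q • ContinuousLinearMap.snd ℝ ℝ ℝ) q := fun q hq => (hZu q hq).2
  have hw : ∀ q ∈ S, HasFDerivAt w (wt q • ContinuousLinearMap.fst ℝ ℝ ℝ +
      wx q • ContinuousLinearMap.snd ℝ ℝ ℝ) q := by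
    intro q hq
    have h1 := hasFDerivAt_of_continuous_partials (f := fun a b => (r a + s b) / 2)
      (fa := fun a _ => r' a / 2) (fb := fun _ b => s' b / 2)
      (fun a b => ((D.hasDerivAt_r a).add_const (s b)).div_const 2)
      (fun a b => ((D.hasDerivAt_s b).const_add (r a)).div_const 2)
      (by fun_prop) (by fun_prop) (Z q)
    refine HasFDerivAt.congr_fderiv (f := w) (h1.comp q (hZu q hq).1) ?_
    have := hL0 (Z q).1 (Z q).2
    have := hP0 (Z q).1 (Z q).2
    have := hQ0 (Z q).1 (Z q).2
    ext <;> simp [wt, wx, rx, sx] <;> field_simp <;> ring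
  have hV : ∀ q ∈ S, HasFDerivAt V (wx q • ContinuousLinearMap.fst ℝ ℝ ℝ +
      vx q • ContinuousLinearMap.snd ℝ ℝ ℝ) q := by
    intro q hq
    have h1 := hasFDerivAt_of_continuous_partials D.hasDerivAt_va D.hasDerivAt_vb
      ((cr.comp continuous_fst).div (continuous_const.mul cL)
        fun z => mul_ne_zero two_ne_zero (hL0 _ _))
      ((cs.comp continuous_snd).neg.div (continuous_const.mul cL)
        fun z => mul_ne_zero two_ne_zero (hL0 _ _)) (Z q)
    refine HasFDerivAt.congr_fderiv (f := V) (h1.comp q (hZu q hq).1) ?_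
    have := hL0 (Z q).1 (Z q).2
    have := hP0 (Z q).1 (Z q).2
    have := hQ0 (Z q).1 (Z q).2
    ext <;> simp [vx, wx, rx, sx] <;> field_simp <;> ring
  have crxZ : ContinuousOn (fun q => rx (Z q)) S := crx.comp_continuousOn cZ
  have csxZ : ContinuousOn (fun q => sx (Z q)) S := csx.comp_continuousOn cZ
  have cLZ : ContinuousOn (fun q => L (Z q).1 (Z q).2) S := cL.comp_continuousOn cZ
  have cwt : ContinuousOn wt S := (cLZ.mul (crxZ.sub csxZ)).div_const 2
  have cwx : ContinuousOn wx S := (crxZ.add csxZ).div_const 2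
  have cvx : ContinuousOn vx S := (crxZ.sub csxZ).div (continuousOn_const.mul cLZ)
    fun z _ => mul_ne_zero two_ne_zero (hL0 _ _)
  have Cw : ContDiffOn ℝ 1 w S := by
    simpa using contDiffOn_succ_of_hasFDerivAt hSo 0 hw (by simpa using cwt) (by simpa using cwx)
  have CV : ContDiffOn ℝ 1 V S := by
    simpa using contDiffOn_succ_of_hasFDerivAt hSo 0 hV (by simpa using cwx) (by simpa using cvx)
  have Cu : ContDiffOn ℝ 2 u S := by
    have := contDiffOn_succ_of_hasFDerivAt hSo 1 hu (by simpa using Cw) (by simpa using CV)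
    convert this using 1
    norm_num
  have memS : ∀ t ∈ Ico 0 T, ∀ x : ℝ, (t, x) ∈ S := fun t ht x => by
    change |t| < T
    rw [abs_of_nonneg ht.1]; exact ht.2
  have e_t : ∀ t ∈ Ico 0 T, ∀ x, dt (fun t x => u (t, x)) t x = w (t, x) := fun t ht x =>
    dt_eq_of_hasFDerivAt ht.1 (hu _ (memS t ht x))
  have e_x : ∀ t ∈ Ico 0 T, ∀ x, dx (fun t x => u (t, x)) t x = V (t, x) := fun t ht x =>
    dx_eq_of_hasFDerivAt (hu _ (memS t ht x))
  have e_tt : ∀ t ∈ Ico 0 T, ∀ x, dt (dt fun t x => u (t, x)) t x = wt (t, x) := fun t ht x =>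
    (dt_congr (g := fun t x => w (t, x)) ht fun s hs => e_t s hs x).trans
      (dt_eq_of_hasFDerivAt ht.1 (hw _ (memS t ht x)))
  have e_tx : ∀ t ∈ Ico 0 T, ∀ x, dx (dt fun t x => u (t, x)) t x = wx (t, x) := fun t ht x =>
    (dx_congr (g := fun t x => w (t, x)) fun y => e_t t ht y).trans
      (dx_eq_of_hasFDerivAt (hw _ (memS t ht x)))
  have e_xx : ∀ t ∈ Ico 0 T, ∀ x, dx (dx fun t x => u (t, x)) t x = vx (t, x) := fun t ht x =>
    (dx_congr (g := fun t x => V (t, x)) fun y => e_x t ht y).trans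
      (dx_eq_of_hasFDerivAt (hV _ (memS t ht x)))
  have hwB : ∀ q, |w q| ≤ B := fun q => by
    have h1 := abs_le.1 (hr (Z q).1)
    have h2 := abs_le.1 (hs (Z q).2)
    simp only [w, abs_le]
    constructor <;> linarith
  have huB : ∀ t ∈ Ico 0 T, ∀ x, |u (t, x)| ≤ B + B * T := by
    -- Integrate `|u_t| ≤ B` from the initial value.
    intro t ht x
    have h := (convex_Ico 0 T).norm_image_sub_le_of_norm_hasDerivWithin_le
      (f := fun s => u (s, x)) (f' := fun s => w (s, x)) (C := B)
      (fun s hs => (hasDerivAt_time (hu _ (memS s hs x))).hasDerivWithinAt)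
      (fun s _ => hwB _) (left_mem_Ico.2 hT) ht
    simp only [hu0, Real.norm_eq_abs, sub_zero, abs_of_nonneg ht.1] at h
    have h1 := hu₀B x
    have h2 : B * t ≤ B * T := mul_le_mul_of_nonneg_left ht.2.le hB
    have h3 := abs_le.1 (h.trans h2)
    have h4 := abs_le.1 h1
    rw [abs_le]
    constructor <;> linarith
  have hwtB : ∀ q, |wt q| ≤ 4 * B := fun q => by
    have h1 := abs_le.1 (hrx (Z q))
    have h2 := abs_le.1 (hsx (Z q))
    have h3 := hLb (Z q).1 (Z q).2
    have h4 : |rx (Z q) - sx (Z q)| ≤ 4 * B := by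
      rw [abs_le]; constructor <;> linarith
    simp only [wt]
    rw [abs_div, abs_mul, abs_of_pos (a := L (Z q).1 (Z q).2) (by linarith), abs_two]
    nlinarith [abs_nonneg (rx (Z q) - sx (Z q))]
  have hwxB : ∀ q, |wx q| ≤ 4 * B := fun q => by
    have h1 := abs_le.1 (hrx (Z q))
    have h2 := abs_le.1 (hsx (Z q))
    simp only [wx, abs_le]
    constructor <;> linarith
  have hvxB : ∀ q, |vx q| ≤ 4 * B := fun q => by
    have h1 := abs_le.1 (hrx (Z q))
    have h2 := abs_le.1 (hsx (Z q))
    have h3 := hLb (Z q).1 (Z q).2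
    have h4 : |rx (Z q) - sx (Z q)| ≤ 4 * B := by
      rw [abs_le]; constructor <;> linarith
    simp only [vx]
    rw [abs_div, abs_of_pos (a := 2 * L (Z q).1 (Z q).2) (by linarith), div_le_iff₀ (by linarith)]
    nlinarith
  refine le_sSup ⟨T, hT, rfl, fun t x => u (t, x), ⟨?_, ?_, ?_, ?_, ?_⟩, ?_⟩
  · exact Cu.mono fun q hq => memS q.1 hq.1 q.2
  · intro t ht x; rw [e_x t ht]; exact hU _ _
  · intro t ht x
    rw [e_tt t ht, e_x t ht, e_xx t ht, show c (V (t, x)) = L (Z (t, x)).1 (Z (t, x)).2 from hc _ _]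
    simp only [wt, vx]
    have := hL0 (Z (t, x)).1 (Z (t, x)).2
    field_simp
    ring
  · intro x; exact hu0 x
  · intro x; rw [e_t 0 (left_mem_Ico.2 hT), hu₁]; simp only [w, hZ0]
  · have key : ∀ t ∈ Ico 0 T, size c (fun t x => u (t, x)) t ≤ ENNReal.ofReal (B + B * T) +
        ENNReal.ofReal B + ENNReal.ofReal B + ENNReal.ofReal (4 * B) + ENNReal.ofReal (4 * B) +
        ENNReal.ofReal (4 * B) + 2 := by
      intro t ht
      unfold size
      refine add_le_add (add_le_add (add_le_add (add_le_add (add_le_add (add_le_add ?_ ?_) ?_) ?_)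
        ?_) ?_) ?_
      · exact eLpNorm_top_le_of_abs_le (huB t ht)
      · exact eLpNorm_top_le_of_abs_le fun x => by rw [e_t t ht]; exact hwB _
      · exact eLpNorm_top_le_of_abs_le fun x => by rw [e_x t ht]; exact hv _ _
      · exact eLpNorm_top_le_of_abs_le fun x => by rw [e_tt t ht]; exact hwtB _
      · exact eLpNorm_top_le_of_abs_le fun x => by rw [e_tx t ht]; exact hwxB _
      · exact eLpNorm_top_le_of_abs_le fun x => by rw [e_xx t ht]; exact hvxB _
      · rw [eLpNorm_exponent_top]
        refine eLpNormEssSup_le_of_ae_enorm_bound (Eventually.of_forall fun x => ?_)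
        rw [e_x t ht, enorm_eq_self]
        refine enorm_inv_le_two ?_
        rw [show c (V (t, x)) = L (Z (t, x)).1 (Z (t, x)).2 from hc _ _]
        linarith [(hLb (Z (t, x)).1 (Z (t, x)).2).1]
    refine (iSup₂_le key).trans_lt ?_
    simp [ENNReal.add_lt_top, ENNReal.ofReal_lt_top, ENNReal.mul_lt_top]

/-! ### Small data and the scaling in `ε` -/

lemma exists_ball_subset_of_isOpen {U : Set ℝ} (hU : IsOpen U) (h0 : (0 : ℝ) ∈ U) :
    ∃ η > 0, ∀ θ : ℝ, |θ| < η → θ ∈ U := by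
  obtain ⟨η, hη, h⟩ := Metric.isOpen_iff.1 hU 0 h0
  exact ⟨η, hη, fun θ hθ => h (by simpa using hθ)⟩

lemma abs_le_mul_of_abs_hasDerivAt_le {f f' : ℝ → ℝ} {η B : ℝ} (hf0 : f 0 = 0)
    (hf : ∀ θ, |θ| < η → HasDerivAt f (f' θ) θ) (hB : ∀ θ, |θ| < η → |f' θ| ≤ B) {θ : ℝ}
    (hθ : |θ| < η) : |f θ| ≤ B * |θ| := by
  have hmem : ∀ y ∈ Ioo (-η) η, |y| < η := fun y hy => abs_lt.2 hy
  have h := (convex_Ioo (-η) η).norm_image_sub_le_of_norm_hasDerivWithin_le (f := f) (f' := f')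
    (C := B) (fun y hy => (hf y (hmem y hy)).hasDerivWithinAt) (fun y hy => hB y (hmem y hy))
    (x := 0) (y := θ) (abs_lt.1 (by rw [abs_zero]; exact (abs_nonneg θ).trans_lt hθ))
    (abs_lt.1 hθ)
  simpa [hf0] using h

/-- The primitive `C` of the wave speed near `0` and its local inverse `Y`. -/
lemma exists_primitive_inverse {U : Set ℝ} (hU : IsOpen U) (h0U : (0 : ℝ) ∈ U) {c : ℝ → ℝ}
    (hc0 : c 0 = 1) (hc : ContinuousOn c U) :
    ∃ (C Y : ℝ → ℝ) (δ : ℝ), 0 < δ ∧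
      (∀ θ, |θ| < δ → |c θ - 1| ≤ 1 / 100 ∧ HasDerivAt C (c θ) θ ∧ |C θ| ≤ 2 * |θ| ∧
        Y (C θ) = θ) ∧
      ∀ y, |y| < δ → Y y ∈ U ∧ |c (Y y) - 1| ≤ 1 / 100 ∧ |Y y| ≤ 2 * |y| ∧
        HasDerivAt Y (1 / c (Y y)) y := by
  have hca : ContinuousAt c 0 := hc.continuousAt (hU.mem_nhds h0U)
  have hev : ∀ᶠ θ in 𝓝 (0 : ℝ), θ ∈ U ∧ |c θ - 1| ≤ 1 / 100 := by
    refine Filter.Eventually.and (hU.mem_nhds h0U) ?_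
    have := hca.eventually_mem (Metric.closedBall_mem_nhds (c 0) (show (0 : ℝ) < 1 / 100 by norm_num))
    simpa [hc0, Real.dist_eq] using this
  obtain ⟨η, hη, hball⟩ := Metric.eventually_nhds_iff.1 hev
  simp only [Real.dist_eq, sub_zero] at hball
  have hI : ∀ θ, |θ| < η → θ ∈ Ioo (-η) η := fun θ h => abs_lt.1 h
  have hcI : ContinuousOn c (Ioo (-η) η) := hc.mono fun θ hθ => (hball (abs_lt.2 hθ)).1
  let C : ℝ → ℝ := fun θ => ∫ y in (0 : ℝ)..θ, c y
  have hC : ∀ θ, |θ| < η → HasDerivAt C (c θ) θ := by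
    intro θ hθ
    refine intervalIntegral.integral_hasDerivAt_right ?_
      (hcI.stronglyMeasurableAtFilter isOpen_Ioo θ (hI θ hθ))
      (hcI.continuousAt (isOpen_Ioo.mem_nhds (hI θ hθ)))
    exact (hcI.mono (ordConnected_Ioo.uIcc_subset (hI 0 (by simpa using hη)) (hI θ hθ))).intervalIntegrable
  have hC0 : C 0 = 0 := by simp [C]
  have hstrict : HasStrictDerivAt C (c 0) 0 := by
    refine hasStrictDerivAt_of_hasDerivAt_of_continuousAt ?_ hca
    refine Metric.eventually_nhds_iff.2 ⟨η, hη, fun θ hθ => hC θ ?_⟩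
    simpa [Real.dist_eq] using hθ
  have hne : c 0 ≠ 0 := by rw [hc0]; exact one_ne_zero
  let e := (hstrict.hasStrictFDerivAt_equiv hne).toOpenPartialHomeomorph C
  have he : ∀ θ, e θ = C θ := fun θ => rfl
  have h0s : (0 : ℝ) ∈ e.source :=
    (hstrict.hasStrictFDerivAt_equiv hne).mem_toOpenPartialHomeomorph_source
  have h0t : (0 : ℝ) ∈ e.target := by
    have := e.map_source h0s
    rwa [he, hC0] at this
  have hY0 : e.symm 0 = 0 := by
    have := e.left_inv h0s
    rwa [he, hC0] at this
  have hYc : ContinuousAt e.symm 0 := e.symm.continuousAt h0t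
  have hYball : ∀ᶠ y in 𝓝 (0 : ℝ), |e.symm y| < η := by
    have := hYc.eventually_mem (Metric.ball_mem_nhds _ hη)
    simpa [hY0] using this
  have hall : ∀ᶠ y in 𝓝 (0 : ℝ), y ∈ e.source ∧ y ∈ e.target ∧ |e.symm y| < η ∧ |y| < η :=
    Filter.Eventually.and (e.open_source.mem_nhds h0s) (Filter.Eventually.and
      (e.open_target.mem_nhds h0t) (hYball.and (continuous_abs.continuousAt.eventually_lt_const
        (by simpa using hη))))
  obtain ⟨δ, hδ, hδb⟩ := Metric.eventually_nhds_iff.1 hall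
  simp only [Real.dist_eq, sub_zero] at hδb
  have hcpos : ∀ θ, |θ| < η → 99 / 100 ≤ c θ ∧ c θ ≤ 101 / 100 := fun θ hθ => by
    have := abs_le.1 (hball hθ).2
    constructor <;> linarith
  have hYd : ∀ y, |y| < δ → HasDerivAt e.symm (1 / c (e.symm y)) y := by
    intro y hy
    obtain ⟨-, ht, hYη, -⟩ := hδb hy
    rw [one_div]
    refine e.hasDerivAt_symm ht ?_ (hC _ hYη)
    linarith [(hcpos _ hYη).1]
  refine ⟨C, e.symm, δ, hδ, fun θ hθ => ?_, fun y hy => ?_⟩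
  · obtain ⟨hs, -, -, hθη⟩ := hδb hθ
    refine ⟨(hball hθη).2, hC θ hθη, ?_, e.left_inv hs⟩
    refine abs_le_mul_of_abs_hasDerivAt_le hC0 hC (fun θ hθ => ?_) hθη
    have := hcpos θ hθ
    rw [abs_le]
    constructor <;> linarith
  · obtain ⟨-, -, hYη, -⟩ := hδb hy
    refine ⟨(hball hYη).1, (hball hYη).2, ?_, hYd y hy⟩
    refine abs_le_mul_of_abs_hasDerivAt_le hY0 hYd (fun y hy => ?_) hy
    obtain ⟨-, -, hYη, -⟩ := hδb hy
    have := hcpos _ hYη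
    rw [abs_of_pos (by apply one_div_pos.2; linarith), div_le_iff₀ (by linarith)]
    linarith

lemma IsCb.exists_derivatives {f : ℝ → ℝ} (hf : IsCb 1 f) :
    ∃ (f' : ℝ → ℝ) (B : ℝ), (∀ x, HasDerivAt f (f' x) x) ∧ Continuous f' ∧
      (∀ x, |f x| ≤ B) ∧ ∀ x, |f' x| ≤ B := by
  obtain ⟨B0, h0⟩ := hf.2 0 (by norm_num)
  obtain ⟨B1, h1⟩ := hf.2 1 le_rfl
  simp only [iteratedDeriv_zero, iteratedDeriv_one] at h0 h1
  have hd : ContDiff ℝ 1 f := by simpa using hf.1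
  exact ⟨deriv f, max B0 B1, fun x => (hd.differentiable one_ne_zero x).hasDerivAt,
    hd.continuous_deriv le_rfl, fun x => (h0 x).trans (le_max_left _ _),
    fun x => (h1 x).trans (le_max_right _ _)⟩

lemma IsCb.deriv {m : ℕ} {f : ℝ → ℝ} (hf : IsCb (m + 1) f) : IsCb m (deriv f) := by
  refine ⟨?_, fun k hk => ?_⟩
  · have h := hf.1
    rw [show ((m + 1 : ℕ) : WithTop ℕ∞) = (m : WithTop ℕ∞) + 1 by push_cast; rfl,
      contDiff_succ_iff_deriv] at h
    exact h.2.2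
  · obtain ⟨B, hB⟩ := hf.2 (k + 1) (by omega)
    exact ⟨B, fun x => by rw [← iteratedDeriv_succ']; exact hB x⟩

lemma IsCb.mono {m n : ℕ} {f : ℝ → ℝ} (hf : IsCb n f) (h : m ≤ n) : IsCb m f :=
  ⟨hf.1.of_le (by exact_mod_cast h), fun k hk => hf.2 k (hk.trans h)⟩

/-- The exponent `q + 1` counts one factor `ε` from the label derivatives of `v` and `q` factors
from `c'(v)`. -/
theorem exists_le_lifespan {U : Set ℝ} (hU : IsOpen U) (h0U : (0 : ℝ) ∈ U) {c : ℝ → ℝ}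
    (hc0 : c 0 = 1) (hc : ContDiffOn ℝ 1 c U) {φ ψ : ℝ → ℝ} (hφ : IsCb 2 φ) (hψ : IsCb 1 ψ)
    {q K η : ℝ} (hq : 0 ≤ q) (hη : 0 < η) (hK : ∀ θ, |θ| < η → |deriv c θ| ≤ K * |θ| ^ q) :
    ∃ ε₀ : ℝ, 0 < ε₀ ∧ ∃ C : ℝ, 0 < C ∧ ∀ ε : ℝ, 0 < ε → ε ≤ ε₀ →
      ENNReal.ofReal (C * ε ^ (-(q + 1))) ≤
        lifespan U c (fun x => ε * φ x) (fun x => ε * ψ x) := by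
  obtain ⟨C, Y, δ, hδ, hC, hY⟩ := exists_primitive_inverse hU h0U hc0 hc.continuousOn
  obtain ⟨φ₁, B0, hφd, -, hφ0B, hφ1B⟩ := (hφ.mono one_le_two).exists_derivatives
  obtain ⟨φ₂, B1, hφ1d, hφ2c, -, hφ2B⟩ := (IsCb.deriv (m := 1) hφ).exists_derivatives
  obtain rfl : _root_.deriv φ = φ₁ := funext fun x => (hφd x).deriv
  obtain ⟨ψ₁, B2, hψd, hψ1c, hψ0B, hψ1B⟩ := hψ.exists_derivatives
  obtain ⟨M, hM, hM0, hM1, hM2⟩ : ∃ M : ℝ, 0 < M ∧ B0 ≤ M ∧ B1 ≤ M ∧ B2 ≤ M :=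
    ⟨max 1 (max B0 (max B1 B2)), by positivity, by simp, by simp, by simp⟩
  have hK₁ : 0 < |K| + 1 := by positivity
  -- `6Mε` bounds `v` and `3Mε` bounds its label derivatives, so `A ε^(q+1)` serves as `κ`; `|K| +
  -- 1` keeps `A` positive.
  set A : ℝ := (|K| + 1) * (6 * M) ^ q * (3 * M) with hA
  have hA0 : 0 < A := by positivity
  -- The `7` puts `6Mε` strictly below `δ` and `η`; the second constant gives `1800 κ T = 1`.
  refine ⟨min δ η / (7 * M), by positivity, 1 / (1800 * A), by positivity, fun ε hε hε₀ => ?_⟩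
  have hεM : 7 * (M * ε) ≤ min δ η := by
    rw [le_div_iff₀ (by positivity)] at hε₀; linarith
  have hMε : 0 < M * ε := by positivity
  have h6δ : 6 * (M * ε) < δ := by linarith [min_le_left δ η]
  have h6η : 6 * (M * ε) < η := by linarith [min_le_right δ η]
  have sc : ∀ {a B : ℝ}, |a| ≤ B → B ≤ M → |ε * a| ≤ M * ε := fun {a B} h1 h2 => by
    rw [abs_mul, abs_of_pos hε, mul_comm]
    exact mul_le_mul_of_nonneg_right (h1.trans h2) hε.le
  have hvδ : ∀ x, |ε * deriv φ x| < δ := fun x => (sc (hφ1B x) hM0).trans_lt (by linarith)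
  let r : ℝ → ℝ := fun a => ε * ψ a + C (ε * deriv φ a)
  let s : ℝ → ℝ := fun a => ε * ψ a - C (ε * deriv φ a)
  let r' : ℝ → ℝ := fun a => ε * ψ₁ a + c (ε * deriv φ a) * (ε * φ₂ a)
  let s' : ℝ → ℝ := fun a => ε * ψ₁ a - c (ε * deriv φ a) * (ε * φ₂ a)
  have hCd : ∀ a, HasDerivAt (fun a => C (ε * deriv φ a)) (c (ε * deriv φ a) * (ε * φ₂ a)) a :=
    fun a => HasDerivAt.comp (h₂ := C) a (hC _ (hvδ a)).2.1 ((hφ1d a).const_mul ε)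
  have hrd : ∀ a, HasDerivAt r (r' a) a := fun a => ((hψd a).const_mul ε).add (hCd a)
  have hsd : ∀ a, HasDerivAt s (s' a) a := fun a => ((hψd a).const_mul ε).sub (hCd a)
  have hCB : ∀ a, |C (ε * deriv φ a)| ≤ 2 * (M * ε) := fun a =>
    (hC _ (hvδ a)).2.2.1.trans (by linarith [sc (hφ1B a) hM0])
  have hcB : ∀ a, |c (ε * deriv φ a) * (ε * φ₂ a)| ≤ 2 * (M * ε) := fun a => by
    have h1 := abs_le.1 (hC _ (hvδ a)).1
    rw [abs_mul]
    refine mul_le_mul ?_ (sc (hφ2B a) hM1) (abs_nonneg _) zero_le_two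
    rw [abs_le]; constructor <;> linarith
  have hrB : ∀ a, |r a| ≤ 3 * (M * ε) := fun a =>
    (abs_add_le _ _).trans (by linarith [sc (hψ0B a) hM2, hCB a])
  have hsB : ∀ a, |s a| ≤ 3 * (M * ε) := fun a =>
    (abs_sub _ _).trans (by linarith [sc (hψ0B a) hM2, hCB a])
  have hr'B : ∀ a, |r' a| ≤ 3 * (M * ε) := fun a =>
    (abs_add_le _ _).trans (by linarith [sc (hψ1B a) hM2, hcB a])
  have hs'B : ∀ a, |s' a| ≤ 3 * (M * ε) := fun a =>
    (abs_sub _ _).trans (by linarith [sc (hψ1B a) hM2, hcB a])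
  have hyB : ∀ a b, |(r a - s b) / 2| ≤ 3 * (M * ε) := fun a b => by
    have h1 := abs_le.1 (hrB a)
    have h2 := abs_le.1 (hsB b)
    rw [abs_le]; constructor <;> linarith
  have hyδ : ∀ a b, |(r a - s b) / 2| < δ := fun a b => (hyB a b).trans_lt (by linarith)
  let v : ℝ → ℝ → ℝ := fun a b => Y ((r a - s b) / 2)
  have hvU : ∀ a b, v a b ∈ U := fun a b => (hY _ (hyδ a b)).1
  have hvB : ∀ a b, |v a b| ≤ 6 * (M * ε) := fun a b =>
    (hY _ (hyδ a b)).2.2.1.trans (by linarith [hyB a b])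
  have hL1 : ∀ a b, |c (v a b) - 1| ≤ 1 / 100 := fun a b => (hY _ (hyδ a b)).2.1
  have hL0 : ∀ a b, c (v a b) ≠ 0 := fun a b => by
    have := abs_le.1 (hL1 a b); linarith
  -- On the diagonal the labels coincide and `v` must return the initial slope.
  have hvdiag : ∀ a, v a a = ε * deriv φ a := fun a => by
    simp only [v]
    rw [show (r a - s a) / 2 = C (ε * deriv φ a) by simp only [r, s]; ring]
    exact (hC _ (hvδ a)).2.2.2
  have hcd : ∀ θ ∈ U, HasDerivAt c (deriv c θ) θ := fun θ hθ =>
    ((hc.differentiableOn one_ne_zero).differentiableAt (hU.mem_nhds hθ)).hasDerivAt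
  have hc' := hc.continuousOn_deriv_of_isOpen hU le_rfl
  have cr : Continuous r := continuous_iff_continuousAt.2 fun a => (hrd a).continuousAt
  have cs : Continuous s := continuous_iff_continuousAt.2 fun a => (hsd a).continuousAt
  have cv : Continuous fun z : ℝ × ℝ => v z.1 z.2 := continuous_iff_continuousAt.2 fun z =>
    ContinuousAt.comp (f := fun z : ℝ × ℝ => (r z.1 - s z.2) / 2)
      (hY _ (hyδ z.1 z.2)).2.2.2.continuousAt (by fun_prop)
  have ccv : Continuous fun z : ℝ × ℝ => c (v z.1 z.2) :=
    hc.continuousOn.comp_continuous cv fun z => hvU _ _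
  have cc'v : Continuous fun z : ℝ × ℝ => deriv c (v z.1 z.2) :=
    hc'.comp_continuous cv fun z => hvU _ _
  have ccφ : Continuous fun a => c (ε * deriv φ a) := by
    simp only [← hvdiag]
    exact ccv.comp (by fun_prop : Continuous fun a : ℝ => (a, a))
  have cr' : Continuous r' :=
    (continuous_const.mul hψ1c).add (ccφ.mul (continuous_const.mul hφ2c))
  have cs' : Continuous s' :=
    (continuous_const.mul hψ1c).sub (ccφ.mul (continuous_const.mul hφ2c))
  have hva : ∀ a b, HasDerivAt (fun y => v y b) (r' a / (2 * c (v a b))) a := fun a b =>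
    (HasDerivAt.comp (h₂ := Y) a (hY _ (hyδ a b)).2.2.2
      (((hrd a).sub_const (s b)).div_const 2)).congr_deriv (by
        have := hL0 a b; simp only [v] at this ⊢; field_simp)
  have hvb : ∀ a b, HasDerivAt (fun y => v a y) (-s' b / (2 * c (v a b))) b := fun a b =>
    (HasDerivAt.comp (h₂ := Y) b (hY _ (hyδ a b)).2.2.2
      (((hsd b).const_sub (r a)).div_const 2)).congr_deriv (by
        have := hL0 a b; simp only [v] at this ⊢; field_simp)
  have hest : ∀ a b e, |e| ≤ 3 * (M * ε) →
      |deriv c (v a b) * (e / (2 * c (v a b)))| ≤ A * ε ^ (q + 1) := by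
    intro a b e he
    have h1 := abs_le.1 (hL1 a b)
    have h2 : |e / (2 * c (v a b))| ≤ 3 * (M * ε) := by
      rw [abs_div, abs_of_pos (a := 2 * c (v a b)) (by linarith), div_le_iff₀ (by linarith)]
      nlinarith
    have h3 : |deriv c (v a b)| ≤ (|K| + 1) * (6 * (M * ε)) ^ q := by
      refine (hK _ ((hvB a b).trans_lt h6η)).trans ?_
      refine mul_le_mul (by linarith [le_abs_self K]) ?_ (by positivity) hK₁.le
      exact Real.rpow_le_rpow (abs_nonneg _) (hvB a b) hq
    rw [abs_mul]
    refine (mul_le_mul h3 h2 (abs_nonneg _) (by positivity)).trans (le_of_eq ?_)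
    rw [hA, show 6 * (M * ε) = 6 * M * ε by ring, Real.mul_rpow (by positivity) hε.le,
      Real.rpow_add_one hε.ne']
    ring
  have D : RiemannData r s r' s' (fun a b => c (v a b)) v
      (fun a b => deriv c (v a b) * (r' a / (2 * c (v a b))))
      (fun a b => deriv c (v a b) * (-s' b / (2 * c (v a b)))) (A * ε ^ (q + 1)) :=
    { hasDerivAt_r := hrd
      hasDerivAt_s := hsd
      continuous_r' := cr'
      continuous_s' := cs'
      continuous_L := ccv
      continuous_v := cv
      continuous_La := cc'v.mul ((cr'.comp continuous_fst).div (continuous_const.mul ccv)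
        fun z => mul_ne_zero two_ne_zero (hL0 _ _))
      continuous_Lb := cc'v.mul ((cs'.comp continuous_snd).neg.div (continuous_const.mul ccv)
        fun z => mul_ne_zero two_ne_zero (hL0 _ _))
      hasDerivAt_La := fun a b => HasDerivAt.comp (h₂ := c) a (hcd _ (hvU a b)) (hva a b)
      hasDerivAt_Lb := fun a b => HasDerivAt.comp (h₂ := c) b (hcd _ (hvU a b)) (hvb a b)
      hasDerivAt_va := hva
      hasDerivAt_vb := hvb
      abs_L_sub_one_le := hL1
      abs_La_le := fun a b => hest a b _ (hr'B a)
      abs_Lb_le := fun a b => hest a b _ (by rw [abs_neg]; exact hs'B b) }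
  have h36 : ∀ {x : ℝ}, x ≤ 3 * (M * ε) → x ≤ 6 * (M * ε) := fun {x} h => by linarith
  refine D.le_lifespan (B := 6 * (M * ε)) (by positivity) ?_ hvU (fun a b => rfl) (fun a => ?_)
    (fun a => ?_) (fun a => h36 (hrB a)) (fun a => h36 (hsB a)) (fun a => h36 (hr'B a))
    (fun a => h36 (hs'B a)) hvB (fun a => ?_)
  · have h1 : ε ^ (q + 1) * ε ^ (-(q + 1)) = 1 := by
      rw [← Real.rpow_add hε, add_neg_cancel, Real.rpow_zero]
    refine le_of_eq ?_
    calc 1800 * (A * ε ^ (q + 1)) * (1 / (1800 * A) * ε ^ (-(q + 1)))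
        = ε ^ (q + 1) * ε ^ (-(q + 1)) * (1800 * A / (1800 * A)) := by ring
      _ = 1 := by rw [h1, div_self (by positivity), one_mul]
  · rw [hvdiag]; exact (hφd a).const_mul ε
  · simp only [r, s]; ring
  · linarith [sc (hφ0B a) hM0]

/-! ### Order of vanishing of `c'` -/

lemma hasDerivAt_iteratedDeriv_of_contDiffOn {U : Set ℝ} (hU : IsOpen U) {c : ℝ → ℝ} {m k : ℕ}
    (hc : ContDiffOn ℝ m c U) (hk : k < m) {θ : ℝ} (hθ : θ ∈ U) :
    HasDerivAt (iteratedDeriv k c) (iteratedDeriv (k + 1) c θ) θ := by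
  have h := hc.differentiableOn_iteratedDerivWithin (m := k) (by exact_mod_cast hk) hU.uniqueDiffOn
  have h' : DifferentiableOn ℝ (iteratedDeriv k c) U :=
    h.congr fun x hx => (iteratedDerivWithin_of_isOpen hU hx).symm
  rw [iteratedDeriv_succ]
  exact (h'.differentiableAt (hU.mem_nhds hθ)).hasDerivAt

/-- The derivative of a flat speed is at most `K |θ|^(p - 2)` near `0`. -/
lemma FlatSpeed.abs_deriv_le {p : ℝ} (hp : 2 < p) {U : Set ℝ} (hU : IsOpen U) (h0U : (0 : ℝ) ∈ U)
    {c : ℝ → ℝ} (h : FlatSpeed p U c) :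
    ContDiffOn ℝ 1 c U ∧ ∃ η > 0, ∃ K, ∀ θ, |θ| < η → |deriv c θ| ≤ K * |θ| ^ (p - 2) := by
  obtain ⟨⟨hc, -⟩, hflat, K, hK, hbound⟩ := h
  obtain ⟨η, hη, hηU⟩ := exists_ball_subset_of_isOpen hU h0U
  set m := ⌈p - 2⌉₊ with hm
  have hm1 : 1 ≤ m := Nat.one_le_ceil_iff.2 (by linarith)
  have hceil : (⌈p - 1⌉ : ℝ) = m + 1 := by
    rw [show p - 1 = p - 2 + 1 by ring, Int.ceil_add_one, hm,
      natCast_ceil_eq_intCast_ceil (by linarith)]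
    push_cast; ring
  have hγ : 0 < p - (⌈p - 1⌉ : ℝ) := by
    have := Int.ceil_lt_add_one (p - 1)
    linarith
  -- Descend from order `m`: the lower derivatives vanish at `0`, so each use of the mean value
  -- inequality gains one power of `|θ|`. At `j = m - 1` the exponent is `p - (m + 1) + (m - 1) = p
  -- - 2`.
  have key : ∀ j : ℕ, j < m → ∀ θ, |θ| < η →
      |iteratedDeriv (m - j) c θ| ≤ K * |θ| ^ (p - (⌈p - 1⌉ : ℝ) + j) := by
    intro j
    induction j with
    | zero => intro _ θ hθ; simpa using hbound θ (hηU θ hθ)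
    | succ j ih =>
      intro hj θ hθ
      have hk : m - j = m - (j + 1) + 1 := by omega
      have hmv := (convex_uIcc 0 θ).norm_image_sub_le_of_norm_hasDerivWithin_le
        (f := iteratedDeriv (m - (j + 1)) c) (f' := iteratedDeriv (m - j) c)
        (C := K * |θ| ^ (p - (⌈p - 1⌉ : ℝ) + j)) (x := 0) (y := θ) (fun y hy => ?_) (fun y hy => ?_)
        left_mem_uIcc right_mem_uIcc
      · rw [hflat _ (by omega) (by omega), sub_zero, sub_zero] at hmv
        refine hmv.trans (le_of_eq ?_)
        rw [Real.norm_eq_abs, Nat.cast_succ, ← add_assoc,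
          Real.rpow_add_one' (abs_nonneg θ) (by positivity)]
        ring
      · have hy' : |y| ≤ |θ| := by simpa using abs_sub_left_of_mem_uIcc hy
        rw [hk]
        exact (hasDerivAt_iteratedDeriv_of_contDiffOn hU hc (by omega)
          (hηU y (hy'.trans_lt hθ))).hasDerivWithinAt
      · have hy' : |y| ≤ |θ| := by simpa using abs_sub_left_of_mem_uIcc hy
        refine (ih (by omega) y (hy'.trans_lt hθ)).trans ?_
        refine mul_le_mul_of_nonneg_left ?_ hK.le
        exact Real.rpow_le_rpow (abs_nonneg _) hy' (by positivity)
  refine ⟨hc.of_le (by exact_mod_cast hm1), η, hη, K, fun θ hθ => ?_⟩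
  have := key (m - 1) (by omega) θ hθ
  rw [Nat.sub_sub_self hm1, iteratedDeriv_one, Nat.cast_sub hm1, hceil] at this
  convert this using 3
  push_cast; ring

lemma exists_abs_deriv_le {U : Set ℝ} (hU : IsOpen U) (h0U : (0 : ℝ) ∈ U) {c : ℝ → ℝ}
    (hc : ContDiffOn ℝ 1 c U) :
    ∃ η > 0, ∃ K, ∀ θ, |θ| < η → |deriv c θ| ≤ K * |θ| ^ (0 : ℝ) := by
  have h := (hc.continuousOn_deriv_of_isOpen hU le_rfl).continuousAt (hU.mem_nhds h0U)
  obtain ⟨η, hη, hb⟩ := Metric.eventually_nhds_iff.1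
    (h.abs.eventually_lt_const (lt_add_one |deriv c 0|))
  refine ⟨η, hη, |deriv c 0| + 1, fun θ hθ => ?_⟩
  rw [Real.rpow_zero, mul_one]
  exact (hb (by simpa using hθ)).le

end QuasilinearWave

theorem theorem1 (U : Set ℝ) (hU : IsOpen U) (h0U : (0 : ℝ) ∈ U)
    (c : ℝ → ℝ) (hc0 : c 0 = 1)
    (φ ψ : ℝ → ℝ) (hφ : QuasilinearWave.IsCb 2 φ) (hψ : QuasilinearWave.IsCb 1 ψ) :
    (∀ p : ℝ, 2 < p → QuasilinearWave.FlatSpeed p U c →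
      ∃ ε₀ : ℝ, 0 < ε₀ ∧ ∃ C : ℝ, 0 < C ∧ ∀ ε : ℝ, 0 < ε → ε ≤ ε₀ →
        ENNReal.ofReal (C * ε ^ (-(p - 1))) ≤
          QuasilinearWave.lifespan U c (fun x => ε * φ x) (fun x => ε * ψ x)) ∧
    (ContDiffOn ℝ 1 c U → deriv c 0 ≠ 0 →
      ∃ ε₀ : ℝ, 0 < ε₀ ∧ ∃ C : ℝ, 0 < C ∧ ∀ ε : ℝ, 0 < ε → ε ≤ ε₀ →
        ENNReal.ofReal (C * ε⁻¹) ≤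
          QuasilinearWave.lifespan U c (fun x => ε * φ x) (fun x => ε * ψ x)) := by
  refine ⟨fun p hp hflat => ?_, fun hc _ => ?_⟩
  · obtain ⟨hc, η, hη, K, hK⟩ := hflat.abs_deriv_le hp hU h0U
    have := QuasilinearWave.exists_le_lifespan hU h0U hc0 hc hφ hψ (by linarith) hη hK
    rwa [show p - 2 + 1 = p - 1 by ring] at this
  · obtain ⟨η, hη, K, hK⟩ := QuasilinearWave.exists_abs_deriv_le hU h0U hc
    have := QuasilinearWave.exists_le_lifespan hU h0U hc0 hc hφ hψ le_rfl hη hK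
    simpa only [zero_add, Real.rpow_neg_one] using this
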